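/- Let $\Omega=\{0,1\}^{\mathbb Z}$ carry the product $\sigma$-algebra $\mathscr F$, let $\mu_p=\mathrm{Ber}(p)^{\otimes\mathbb Z}$, and let $T:\Omega\to\Omega$, $(T\omega)_i=\omega_i\bigl(1-(1-\omega_{i-1})(1-\omega_{i+1})\bigr)$, be the map that removes isolated occupied sites. Put $\Omega'=T(\Omega)$, with the trace $\sigma$-algebra $\mathscr F'$, and let $\mathscr F'_S$ be the trace on $\Omega'$ of the $\sigma$-algebra generated by the spins in $S\subset\mathbb Z$. The thinned Bernoulli field is $\mu'_p=\mu_p\circ T^{-1}$ on $\Omega'$. Regard $\mathbb Z$ as the nearest-neighbour graph. For $S\subset\mathbb Z$ let $\partial_+S$ be the set of sites outside $S$ that have a neighbour in $S$, and $\overline S=S\cup\partial_+S$. For $\omega'\in\Omega'$ let $\Theta=\{x:\omega'_x=1\}$, let $\mathscr U(\omega')$ be the set of connected components of $(\overline\Theta)^c$, and for finite $\Lambda\subset\mathbb Z$ let $\mathscr U_\Lambda(\omega')=\{U\in\mathscr U(\omega'):\operatorname{dist}(\overline\Lambda,U)\le 1\}$, which is a finite set. (Here $\operatorname{dist}(\emptyset,U)=\infty$.)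 Put $$Q=\begin{pmatrix}1-p&\sqrt{p(1-p)}\\ \sqrt{p(1-p)}&0\end{pmatrix},\qquad \lambda=\tfrac12\Bigl(1-p+\sqrt{(1-p)(3p+1)}\Bigr),\qquad D=\frac{(1-p)(\lambda+2p)}{\lambda^3},$$ where the rows and columns of $Q$ are indexed by $0,1$ and $\lambda$ is the Perron–Frobenius eigenvalue of $Q$. For non-empty $\Lambda$ put $V_-=[\min\overline\Lambda,\infty)\cap\mathbb Z$ and $V_+=(-\infty,\max\overline\Lambda]\cap\mathbb Z$, and for $U\in\mathscr U_\Lambda(\omega')$ let $$Z(U)=(1-p)^{-1}\cdot\begin{cases}Q^{|U|+1}(0,0)&\text{if }|U|<\infty,\\ \lambda^{|U\cap V_-|}&\text{if }|U|=\infty\text{ and }\sup U<\infty,\\ \lambda^{|U\cap V_+|}&\text{if }|U|=\infty\text{ and }\inf U>-\infty,\\ D\,\lambda^{|V_-\cap V_+|}&\text{if } U=\mathbb Z.\end{cases}$$ **Theorem.** For every $p\in(0,1)$ there is a specification $\gamma'_p=(\gamma'_{p,\Lambda})_{\Lambda}$ on $\Omega'$, indexed by the finite subsets $\Lambda$ of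 $\mathbb Z$ (that is, a family of probability kernels $\gamma'_{p,\Lambda}$ from $(\Omega',\mathscr F'_{\Lambda^c})$ to $(\Omega',\mathscr F')$ that are proper, $\gamma'_{p,\Lambda}(A|\cdot)=\mathbf 1_A$ for all $A\in\mathscr F'_{\Lambda^c}$, and consistent, $\gamma'_{p,\Delta}\gamma'_{p,\Lambda}=\gamma'_{p,\Delta}$ for $\Lambda\subset\Delta$), for which $\mu'_p$ is a Gibbs measure, that is, $\mu'_p(A|\mathscr F'_{\Lambda^c})=\gamma'_{p,\Lambda}(A|\cdot)$ holds $\mu'_p$-almost surely for all finite $\Lambda$ and all $A\in\mathscr F'$, and such that for all finite $\Lambda\subset\mathbb Z$ and all $\omega'\in\Omega'$ $$\gamma'_{p,\Lambda}(\omega'_\Lambda\mid\omega'_{\Lambda^c})=\frac{1}{Z_\Lambda(\omega'_{\Lambda^c})}\,p^{|\Theta\cap\overline\Lambda|}(1-p)^{|\partial_+\Theta\cap\overline\Lambda|}\prod_{U\in\mathscr U_\Lambda(\omega')}Z(U).$$ Here the left-hand side is the probability under $\gamma'_{p,\Lambda}(\cdot\,|\,\omega')$ that the configuration agrees with $\omega'$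 on $\Lambda$, and $Z_\Lambda(\omega'_{\Lambda^c})>0$ is the normalizing constant, the (finite) sum of $p^{|\Theta\cap\overline\Lambda|}(1-p)^{|\partial_+\Theta\cap\overline\Lambda|}\prod_{U}Z(U)$ over all configurations in $\Omega'$ that agree with $\omega'$ outside $\Lambda$. -/

import Mathlib

open MeasureTheory ProbabilityTheory
open scoped Matrix

noncomputable section

namespace TBF

/-! ### The graph on the integers -/

/-- The nearest-neighbour graph on `ℤ`. -/
def lineGraph : SimpleGraph ℤ where
  Adj i j := |i - j| = 1
  symm := ⟨fun i j h => by rw [abs_sub_comm]; exact h⟩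
  loopless := ⟨fun i h => by simp at h⟩

/-- The outer boundary `∂₊S`. -/
def outerBoundary (S : Set ℤ) : Set ℤ := {j | j ∉ S ∧ ∃ i ∈ S, lineGraph.Adj j i}

/-- The closure `S ∪ ∂₊S` in the graph. -/
def graphClosure (S : Set ℤ) : Set ℤ := S ∪ outerBoundary S

/-- The connected components, as sets of integers, of the subgraph induced on `S`. -/
def components (S : Set ℤ) : Set (Set ℤ) :=
  {U | ∃ C : (lineGraph.induce S).ConnectedComponent, U = Subtype.val '' C.supp}

/-! ### Configurations and the thinned Bernoulli field -/

/-- Spin configurations on `ℤ`; `true` is the occupied state `1`, `false` the unoccupied state `0`.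
The σ-algebra is the product one. -/
abbrev Config : Type := ℤ → Bool

/-- The Bernoulli-`p` product measure. -/
def bernoulliField (p : unitInterval) : Measure Config :=
  Measure.infinitePi fun _ : ℤ => bernoulliMeasure true false p

/-- The removal of isolated occupied sites,
`(Tω)ᵢ = ωᵢ (1 - (1 - ωᵢ₋₁)(1 - ωᵢ₊₁))`, written with Boolean operations. -/
def thin (ω : Config) : Config := fun i => ω i && !(!ω (i - 1) && !ω (i + 1))

/-- The set of non-isolated configurations, the range of the thinning map. -/
def nonIsolated : Set Config := Set.range thin

/-- The space of non-isolated configurations, with the trace of the product σ-algebra. -/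
abbrev NonIsolated : Type := nonIsolated

/-- The thinning map onto the space of non-isolated configurations. -/
def thinMap (ω : Config) : NonIsolated := ⟨thin ω, ω, rfl⟩

theorem measurable_thinMap : Measurable thinMap := by
  refine Measurable.subtype_mk (measurable_pi_lambda _ fun i => ?_)
  have h : Measurable fun x : Bool × Bool × Bool => x.1 && !(!x.2.1 && !x.2.2) :=
    measurable_of_countable _
  have h' : Measurable fun ω : Config => (ω i, ω (i - 1), ω (i + 1)) :=
    (measurable_pi_apply i).prodMk
      ((measurable_pi_apply (i - 1)).prodMk (measurable_pi_apply (i + 1)))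
  exact h.comp h'

/-- The thinned Bernoulli field. -/
def thinnedField (p : unitInterval) : Measure NonIsolated := (bernoulliField p).map thinMap

instance (p : unitInterval) : IsProbabilityMeasure (thinnedField p) := by
  have : IsProbabilityMeasure (bernoulliField p) := by
    unfold bernoulliField; infer_instance
  exact Measure.isProbabilityMeasure_map measurable_thinMap.aemeasurable

/-! ### Specifications and Gibbs measures on the space of non-isolated configurations -/

/-- The σ-algebra on the full configuration space generated by the spins in `S`. -/
abbrev spinSigma (S : Set ℤ) : MeasurableSpace Config :=
  ⨆ i ∈ S, MeasurableSpace.comap (fun ω : Config => ω i) inferInstance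

/-- The trace on the non-isolated configurations of the σ-algebra generated by the spins in `S`. -/
abbrev spinSigma' (S : Set ℤ) : MeasurableSpace NonIsolated :=
  (spinSigma S).comap Subtype.val

theorem spinSigma'_le (S : Set ℤ) :
    spinSigma' S ≤ (inferInstance : MeasurableSpace NonIsolated) := by
  refine MeasurableSpace.comap_mono ?_
  exact iSup₂_le fun i _ => (measurable_pi_apply (X := fun _ : ℤ => Bool) i).comap_le

/-- A family `γ_Λ`, indexed by the finite subsets of `ℤ`, of kernels from the σ-algebra of the
spins off `Λ` to the full σ-algebra. -/
abbrev KernelFamily : Type :=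
  (Λ : Finset ℤ) → Kernel[spinSigma' (Λ : Set ℤ)ᶜ, inferInstance] NonIsolated NonIsolated

/-- A specification: a consistent family of proper probability kernels. -/
structure IsSpecification (γ : KernelFamily) : Prop where
  isProbability : ∀ (Λ : Finset ℤ) (ω : NonIsolated), IsProbabilityMeasure (γ Λ ω)
  proper : ∀ (Λ : Finset ℤ) (A : Set NonIsolated), MeasurableSet[spinSigma' (Λ : Set ℤ)ᶜ] A →
    ∀ ω : NonIsolated, γ Λ ω A = A.indicator 1 ω
  consistent : ∀ Λ Δ : Finset ℤ, Λ ⊆ Δ → ∀ A : Set NonIsolated, MeasurableSet A →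
    ∀ ω : NonIsolated, ∫⁻ η, γ Λ η A ∂(γ Δ ω) = γ Δ ω A

/-- The DLR equations: `γ_Λ(A | ·)` is a version of the conditional probability of `A` given the
spins off `Λ`. -/
def IsGibbs (μ : Measure NonIsolated) (γ : KernelFamily) : Prop :=
  ∀ (Λ : Finset ℤ) (A : Set NonIsolated), MeasurableSet A →
    μ⟦A | spinSigma' (Λ : Set ℤ)ᶜ⟧ =ᵐ[μ] fun ω => (γ Λ ω).real A

/-! ### Fixed and unfixed areas -/

/-- The set `Θ(ω)` of occupied sites. -/
def occupied (ω : Config) : Set ℤ := {x | ω x = true}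

/-- The fixed area `Θ ∪ ∂₊Θ`. -/
def fixedArea (ω : Config) : Set ℤ := graphClosure (occupied ω)

/-- The connected components of the unfixed area. -/
def unfixed (ω : Config) : Set (Set ℤ) := components (fixedArea ω)ᶜ

/-- The components of the unfixed area at distance at most one from the closure of `Λ`. -/
def unfixedNear (Λ : Finset ℤ) (ω : Config) : Set (Set ℤ) :=
  {U ∈ unfixed ω | ∃ x ∈ graphClosure (Λ : Set ℤ), ∃ y ∈ U, |x - y| ≤ 1}

theorem graphClosure_finite (Λ : Finset ℤ) : (graphClosure (Λ : Set ℤ)).Finite := by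
  refine Set.Finite.subset (Λ.finite_toSet.biUnion fun i _ => Set.finite_Icc (i - 1) (i + 1)) ?_
  rintro j (hj | ⟨-, i, hi, hij⟩)
  · exact Set.mem_biUnion hj ⟨by omega, by omega⟩
  · have h : |j - i| ≤ 1 := le_of_eq hij
    rw [abs_le] at h
    exact Set.mem_biUnion hi ⟨by omega, by omega⟩

theorem unfixedNear_finite (Λ : Finset ℤ) (ω : Config) : (unfixedNear Λ ω).Finite := by
  classical
  let f : ℤ → Set ℤ := fun y =>
    if h : y ∈ (fixedArea ω)ᶜ then
      Subtype.val '' ((lineGraph.induce (fixedArea ω)ᶜ).connectedComponentMk ⟨y, h⟩).supp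
    else ∅
  refine Set.Finite.subset (((graphClosure_finite Λ).biUnion
    fun i _ => Set.finite_Icc (i - 1) (i + 1)).image f) ?_
  rintro U ⟨⟨C, rfl⟩, x, hx, y, ⟨⟨y, hy⟩, hyC, rfl⟩, hxy⟩
  change |x - y| ≤ 1 at hxy
  rw [abs_le] at hxy
  refine ⟨y, Set.mem_biUnion hx ⟨by omega, by omega⟩, ?_⟩
  have hC : (lineGraph.induce (fixedArea ω)ᶜ).connectedComponentMk ⟨y, hy⟩ = C := hyC
  simp only [f, dif_pos hy, hC]

/-! ### The transfer matrix and the kernels -/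

/-- The transfer matrix `Q` of the model constrained on isolation. -/
def transferMatrix (p : ℝ) : Matrix (Fin 2) (Fin 2) ℝ :=
  !![1 - p, √(p * (1 - p)); √(p * (1 - p)), 0]

/-- The Perron–Frobenius eigenvalue of the transfer matrix. -/
def eigenvaluePF (p : ℝ) : ℝ := (1 - p + √((1 - p) * (3 * p + 1))) / 2

/-- `eigenvaluePF p` is positive and has an eigenvector with positive entries, which characterizes
the Perron–Frobenius eigenvalue of the irreducible non-negative matrix `transferMatrix p`. -/
theorem eigenvaluePF_spec (p : ℝ) (hp0 : 0 < p) (hp1 : p < 1) :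
    0 < eigenvaluePF p ∧ ∃ v : Fin 2 → ℝ, (∀ i, 0 < v i) ∧
      transferMatrix p *ᵥ v = eigenvaluePF p • v := by
  have h1 : 0 < 1 - p := by linarith
  have hl : 0 < eigenvaluePF p := by unfold eigenvaluePF; positivity
  have hs : 0 < √(p * (1 - p)) := Real.sqrt_pos.2 (by positivity)
  have hs2 : √(p * (1 - p)) * √(p * (1 - p)) = p * (1 - p) := Real.mul_self_sqrt (by positivity)
  have hr : √((1 - p) * (3 * p + 1)) * √((1 - p) * (3 * p + 1)) = (1 - p) * (3 * p + 1) :=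
    Real.mul_self_sqrt (by positivity)
  refine ⟨hl, ![eigenvaluePF p, √(p * (1 - p))], ?_, ?_⟩
  · intro i
    fin_cases i
    · exact hl
    · exact hs
  · ext i
    fin_cases i
    · simp only [transferMatrix, eigenvaluePF, Matrix.mulVec, dotProduct, Fin.sum_univ_two]
      simp
      nlinarith
    · simp [transferMatrix, Matrix.mulVec, dotProduct, Fin.sum_univ_two, mul_comm]

/-- The constant `D`. -/
def constD (p : ℝ) : ℝ := (1 - p) * (eigenvaluePF p + 2 * p) / eigenvaluePF p ^ 3

/-- `V₋ = [min S, ∞)` where `S` is the closure of the (non-empty) set `Λ`. -/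
def rightRay (Λ : Finset ℤ) : Set ℤ := Set.Ici (sInf (graphClosure (Λ : Set ℤ)))

/-- `V₊ = (-∞, max S]` where `S` is the closure of the (non-empty) set `Λ`. -/
def leftRay (Λ : Finset ℤ) : Set ℤ := Set.Iic (sSup (graphClosure (Λ : Set ℤ)))

open Classical in
/-- The partition function `Z(U)` of a component `U` of the unfixed area. -/
def componentZ (p : ℝ) (Λ : Finset ℤ) (U : Set ℤ) : ℝ :=
  (1 - p)⁻¹ *
    if U.Finite then (transferMatrix p ^ (U.ncard + 1)) 0 0
    else if BddAbove U then eigenvaluePF p ^ (U ∩ rightRay Λ).ncard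
    else if BddBelow U then eigenvaluePF p ^ (U ∩ leftRay Λ).ncard
    else constD p * eigenvaluePF p ^ (rightRay Λ ∩ leftRay Λ).ncard

/-- The unnormalized weight: Bernoulli weights of the fixed area within the closure of `Λ`, times
the partition functions of the components of the unfixed area near `Λ`. -/
def weight (p : ℝ) (Λ : Finset ℤ) (ω : Config) : ℝ :=
  p ^ (occupied ω ∩ graphClosure (Λ : Set ℤ)).ncard *
    (1 - p) ^ (outerBoundary (occupied ω) ∩ graphClosure (Λ : Set ℤ)).ncard *
    ∏ U ∈ (unfixedNear_finite Λ ω).toFinset, componentZ p Λ U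

/-- The configuration equal to `ζ` on `Λ` and to `ω` off `Λ`. -/
def glue (Λ : Finset ℤ) (ζ : Λ → Bool) (ω : Config) : Config :=
  fun i => if h : i ∈ Λ then ζ ⟨i, h⟩ else ω i

/-- The normalization `Z_Λ`: the sum of the weights of all non-isolated configurations that agree
with `ω` off `Λ`. -/
def partitionZ (p : ℝ) (Λ : Finset ℤ) (ω : Config) : ℝ :=
  ∑ ζ : Λ → Bool, nonIsolated.indicator (weight p Λ) (glue Λ ζ ω)

end TBF

end

noncomputable section

namespace TBF

/-! ### Components of subsets of the line -/

/-! The kernel for `Λ` is the explicit one: keep the spins off `Λ`, draw those in `Λ` proportionally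
to `weight`, and give weight zero to configurations with isolated occupied sites. Two things must be
shown, consistency of these kernels and the DLR equations for the thinned field.

Consistency is reversibility. For `Λ ⊆ Δ` the quotient of the weights for `Δ` and `Λ` depends only
on the spins off `Λ` (`weightRatio_congr`). Sites outside the closure of `Λ`, and components at
distance more than one from it, do not feel the spins in `Λ`. A finite component near `Λ` has the
same `Z` for both volumes. An infinite one only gains a power of `λ`, and whether a component near
`Λ` reaches `-∞` or `+∞` is decided off `Λ`. This gives the detailed balance relation
`weight_mul_weight_comm`, hence an exchangeable joint law of a draw in `Δ` and its resampling in
`Λ`. Neither this nor the DLR part uses anything about `λ` and `D` beyond positivity.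

For the DLR equations, consider a pattern `η` on `[s, t]` with an occupied pair at each end. A
configuration is thinned to `η` on `[s, t]` iff it is occupied on `Θ`, empty on `∂₊Θ`, and has no
two adjacent occupied sites in any unfixed component in the window. These conditions are
independent, and the last has probability `(1-p)⁻¹ Q^(|U|+1)(0,0)` by a two-step recursion, so the
thinned field gives the pattern exactly its weight for `[s+1, t-1]` (`thinnedField_real_window`).
With detailed balance, the kernels preserve the probability of every such window around `Λ`
(`lintegral_gibbsMeasure_window`). Almost surely there are occupied pairs arbitrarily far out on
both sides, so these windows, together with the measurable subsets of a null set, form a generating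
π-system. Thus the thinned field is invariant under each kernel (`bind_gibbsMeasure`), and
properness upgrades invariance to the conditional probability statement. -/

theorem lineGraph_adj {i j : ℤ} : lineGraph.Adj i j ↔ |i - j| = 1 := Iff.rfl

theorem mem_graphClosure {S : Set ℤ} {x : ℤ} :
    x ∈ graphClosure S ↔ ∃ i ∈ S, |x - i| ≤ 1 := by
  constructor
  · rintro (hx | ⟨-, i, hi, hxi⟩)
    · exact ⟨x, hx, by simp⟩
    · exact ⟨i, hi, le_of_eq hxi⟩
  · rintro ⟨i, hi, hxi⟩
    by_cases hx : x ∈ S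
    · exact Or.inl hx
    · refine Or.inr ⟨hx, i, hi, ?_⟩
      have hne : x ≠ i := fun h => hx (h ▸ hi)
      rw [lineGraph_adj]
      have : 0 < |x - i| := abs_pos.2 (sub_ne_zero.2 hne)
      omega

theorem graphClosure_mono {S T : Set ℤ} (h : S ⊆ T) : graphClosure S ⊆ graphClosure T := by
  intro x hx
  obtain ⟨i, hi, hxi⟩ := mem_graphClosure.1 hx
  exact mem_graphClosure.2 ⟨i, h hi, hxi⟩

/-- An integer interval is traversed by unit steps, so a set closed under unit steps within `S`
absorbs every interval of `S` that starts in it. -/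
theorem mem_of_uIcc_subset_induction {S U : Set ℤ} {y z : ℤ} (hy : y ∈ U)
    (hU : ∀ x ∈ U, ∀ w ∈ S, |x - w| ≤ 1 → w ∈ U) (h : Set.uIcc y z ⊆ S) : z ∈ U := by
  rcases le_total y z with hyz | hyz
  · rw [Set.uIcc_of_le hyz] at h
    have key : ∀ w, y ≤ w → w ≤ z → w ∈ U := by
      intro w hw
      induction w, hw using Int.leInduction with
      | base => exact fun _ => hy
      | succ n hn ih =>
        intro hz
        exact hU n (ih (by omega)) _ (h ⟨by omega, hz⟩) (by simp)
    exact key z hyz le_rfl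
  · rw [Set.uIcc_of_ge hyz] at h
    have key : ∀ w, w ≤ y → z ≤ w → w ∈ U := by
      intro w hw
      induction w, hw using Int.leInductionDown with
      | base => exact fun _ => hy
      | pred n hn ih =>
        intro hz
        exact hU n (ih (by omega)) _ (h ⟨hz, by omega⟩) (by simp)
    exact key z hyz le_rfl

/-- A walk moves by unit steps and so covers all integers between its ends. This trades graph
connectivity for order connectivity, the form used from here on. -/
theorem reachable_induce_iff {S : Set ℤ} (x y : S) :
    (lineGraph.induce S).Reachable x y ↔ Set.uIcc (x : ℤ) y ⊆ S := by
  constructor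
  · rintro ⟨w⟩
    induction w with
    | nil => simp
    | @cons u v w hadj _ ih =>
      refine Set.uIcc_subset_uIcc_union_uIcc.trans (Set.union_subset ?_ ih)
      have h1 : |(u : ℤ) - v| = 1 := hadj
      intro z hz
      have hz' : z = u ∨ z = v := by
        rw [Set.mem_uIcc] at hz
        rcases abs_cases ((u : ℤ) - v) with h | h <;> omega
      rcases hz' with rfl | rfl
      · exact u.2
      · exact v.2
  · intro h
    have key : (y : ℤ) ∈ {z : ℤ | ∃ hz : z ∈ S, (lineGraph.induce S).Reachable x ⟨z, hz⟩} := by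
      refine mem_of_uIcc_subset_induction (S := S) (y := x) ⟨x.2, .refl _⟩ ?_ h
      rintro u ⟨hu, hxu⟩ w hw huw
      refine ⟨hw, ?_⟩
      by_cases huw' : u = w
      · subst huw'; exact hxu
      · refine hxu.trans (SimpleGraph.Adj.reachable ?_)
        have : 0 < |u - w| := abs_pos.2 (sub_ne_zero.2 huw')
        exact (show |u - w| = 1 by omega)
    exact key.2

theorem mem_components_iff_ordConnectedComponent {S U : Set ℤ} :
    U ∈ components S ↔ ∃ y ∈ S, U = Set.ordConnectedComponent S y := by
  have key : ∀ y : S, Subtype.val '' ((lineGraph.induce S).connectedComponentMk y).supp =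
      Set.ordConnectedComponent S y := by
    intro y
    ext z
    simp only [Set.mem_image, SimpleGraph.ConnectedComponent.mem_supp_iff,
      SimpleGraph.ConnectedComponent.eq, Set.mem_ordConnectedComponent]
    constructor
    · rintro ⟨w, hw, rfl⟩
      exact (reachable_induce_iff _ _).1 hw.symm
    · intro h
      have hz : z ∈ S := h Set.right_mem_uIcc
      exact ⟨⟨z, hz⟩, ((reachable_induce_iff y ⟨z, hz⟩).2 h).symm, rfl⟩
  constructor
  · rintro ⟨C, rfl⟩
    induction C using SimpleGraph.ConnectedComponent.ind with
    | h v => exact ⟨v, v.2, key v⟩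
  · rintro ⟨y, hy, rfl⟩
    exact ⟨_, (key ⟨y, hy⟩).symm⟩

theorem ordConnectedComponent_mem_components {S : Set ℤ} {y : ℤ} (hy : y ∈ S) :
    Set.ordConnectedComponent S y ∈ components S :=
  mem_components_iff_ordConnectedComponent.2 ⟨y, hy, rfl⟩

/-- A component is a non-empty interval that is maximal at its ends. -/
theorem mem_components_iff {S U : Set ℤ} :
    U ∈ components S ↔ U.Nonempty ∧ U.OrdConnected ∧ U ⊆ S ∧
      ∀ x ∈ U, ∀ y ∈ S, |x - y| ≤ 1 → y ∈ U := by
  rw [mem_components_iff_ordConnectedComponent]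
  constructor
  · rintro ⟨y, hy, rfl⟩
    refine ⟨⟨y, by simpa using hy⟩, ?_, Set.ordConnectedComponent_subset, ?_⟩
    · infer_instance
    · intro x hx z hz hxz
      refine Set.mem_ordConnectedComponent_trans hx fun w hw => ?_
      have hx' := Set.ordConnectedComponent_subset hx
      have : w = x ∨ w = z := by
        rw [Set.mem_uIcc] at hw
        rw [abs_le] at hxz
        omega
      rcases this with rfl | rfl <;> assumption
  · rintro ⟨⟨y, hy⟩, hord, hsub, hmax⟩
    refine ⟨y, hsub hy, Set.Subset.antisymm (Set.subset_ordConnectedComponent hy hsub) ?_⟩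
    intro z hz
    exact mem_of_uIcc_subset_induction hy hmax hz

theorem components_eq_of_mem {S U V : Set ℤ} {x : ℤ} (hU : U ∈ components S)
    (hV : V ∈ components S) (hxU : x ∈ U) (hxV : x ∈ V) : U = V := by
  have key : ∀ {U V : Set ℤ}, U ∈ components S → V ∈ components S → x ∈ U → x ∈ V → U ⊆ V := by
    intro U V hU hV hxU hxV z hz
    obtain ⟨-, hUo, hUS, -⟩ := mem_components_iff.1 hU
    obtain ⟨-, -, -, hVm⟩ := mem_components_iff.1 hV
    exact mem_of_uIcc_subset_induction hxV hVm ((hUo.uIcc_subset hxU hz).trans hUS)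
  exact (key hU hV hxU hxV).antisymm (key hV hU hxV hxU)

/-- Being a component is tested only within distance one of `U`, so it survives any change of the
ambient set farther away. -/
theorem mem_components_congr {S T U : Set ℤ}
    (h : ∀ x ∈ U, ∀ y, |x - y| ≤ 1 → (y ∈ S ↔ y ∈ T)) (hU : U ∈ components S) :
    U ∈ components T := by
  obtain ⟨h1, h2, h3, h4⟩ := mem_components_iff.1 hU
  exact mem_components_iff.2 ⟨h1, h2, fun x hx => (h x hx x (by simp)).1 (h3 hx),
    fun x hx y hy hxy => h4 x hx y ((h x hx y hxy).2 hy) hxy⟩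

theorem mem_fixedArea {ω : Config} {x : ℤ} :
    x ∈ fixedArea ω ↔ ω (x - 1) = true ∨ ω x = true ∨ ω (x + 1) = true := by
  rw [fixedArea, mem_graphClosure]
  constructor
  · rintro ⟨i, hi, hxi⟩
    rw [abs_le] at hxi
    have : i = x - 1 ∨ i = x ∨ i = x + 1 := by omega
    rcases this with rfl | rfl | rfl
    · exact Or.inl hi
    · exact Or.inr (Or.inl hi)
    · exact Or.inr (Or.inr hi)
  · rintro (h | h | h)
    · exact ⟨_, h, by simp⟩
    · exact ⟨_, h, by simp⟩
    · exact ⟨_, h, by simp⟩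

theorem mem_outerBoundary_occupied {ω : Config} {x : ℤ} :
    x ∈ outerBoundary (occupied ω) ↔ ω x = false ∧ x ∈ fixedArea ω := by
  have hx : x ∈ occupied ω ↔ ω x = true := Iff.rfl
  constructor
  · intro h
    exact ⟨by simpa [hx] using h.1, Or.inr h⟩
  · rintro ⟨h0, h | h⟩
    · rw [hx, h0] at h
      simp at h
    · exact h

theorem fixedArea_congr_of_off {Λ : Finset ℤ} {ω η : Config} (h : ∀ i ∉ Λ, ω i = η i) {x : ℤ}
    (hx : x ∉ graphClosure (Λ : Set ℤ)) : x ∈ fixedArea ω ↔ x ∈ fixedArea η := by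
  have key : ∀ i, |x - i| ≤ 1 → ω i = η i := fun i hi =>
    h i fun hi' => hx (mem_graphClosure.2 ⟨i, hi', hi⟩)
  rw [mem_fixedArea, mem_fixedArea, key (x - 1) (by simp), key x (by simp), key (x + 1) (by simp)]

/-! ### Dependence of the weights on the volume -/

theorem unfixedNear_mono {Λ Δ : Finset ℤ} (h : Λ ⊆ Δ) (ω : Config) :
    unfixedNear Λ ω ⊆ unfixedNear Δ ω := fun _ ⟨hU, x, hx, hy⟩ =>
  ⟨hU, x, graphClosure_mono (by exact_mod_cast h) hx, hy⟩

/-- A component that is not near `Λ` has its whole unit neighbourhood outside the closure of `Λ`,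
where the fixed area is a function of the spins off `Λ`. -/
theorem unfixedNear_diff_congr {Λ Δ : Finset ℤ} {ω η : Config} (h : ∀ i ∉ Λ, ω i = η i) :
    unfixedNear Δ ω \ unfixedNear Λ ω = unfixedNear Δ η \ unfixedNear Λ η := by
  have key : ∀ {ω η : Config}, (∀ i ∉ Λ, ω i = η i) →
      unfixedNear Δ ω \ unfixedNear Λ ω ⊆ unfixedNear Δ η \ unfixedNear Λ η := by
    rintro ω η h U ⟨⟨hU, hΔ⟩, hfar⟩
    have hfar' : ∀ x ∈ U, ∀ y, |x - y| ≤ 1 → y ∉ graphClosure (Λ : Set ℤ) :=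
      fun x hx y hxy hy => hfar ⟨hU, y, hy, x, hx, by rwa [abs_sub_comm]⟩
    refine ⟨⟨mem_components_congr (fun x hx y hxy => ?_) hU, hΔ⟩, ?_⟩
    · exact not_congr (fixedArea_congr_of_off h (hfar' x hx y hxy))
    · rintro ⟨-, y, hy, x, hx, hxy⟩
      exact hfar' x hx y (by rwa [abs_sub_comm]) hy
  exact (key h).antisymm (key fun i hi => (h i hi).symm)

theorem mem_of_not_bddBelow {U : Set ℤ} (hU : U.OrdConnected) (hb : ¬ BddBelow U) {y z : ℤ}
    (hy : y ∈ U) (hzy : z ≤ y) : z ∈ U := by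
  rw [not_bddBelow_iff] at hb
  obtain ⟨w, hw, hwz⟩ := hb z
  exact hU.out hw hy ⟨hwz.le, hzy⟩

theorem mem_of_not_bddAbove {U : Set ℤ} (hU : U.OrdConnected) (hb : ¬ BddAbove U) {y z : ℤ}
    (hy : y ∈ U) (hyz : y ≤ z) : z ∈ U := by
  rw [not_bddAbove_iff] at hb
  obtain ⟨w, hw, hzw⟩ := hb z
  exact hU.out hy hw ⟨hyz, hzw.le⟩

theorem graphClosure_subset_Icc (Λ : Finset ℤ) : graphClosure (Λ : Set ℤ) ⊆
    Set.Icc (sInf (graphClosure (Λ : Set ℤ))) (sSup (graphClosure (Λ : Set ℤ))) := fun _ hx =>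
  ⟨csInf_le (graphClosure_finite Λ).bddBelow hx, le_csSup (graphClosure_finite Λ).bddAbove hx⟩

theorem ncard_inter_Ici {U : Set ℤ} {a b : ℤ} (hab : a ≤ b) (hU : BddAbove U)
    (h : Set.Ico a b ⊆ U) :
    (U ∩ Set.Ici a).ncard = (U ∩ Set.Ici b).ncard + (b - a).toNat := by
  have hfin : (U ∩ Set.Ici b).Finite := by
    obtain ⟨c, hc⟩ := hU
    exact (Set.finite_Icc b c).subset fun x hx => ⟨hx.2, hc hx.1⟩
  have heq : U ∩ Set.Ici a = (U ∩ Set.Ici b) ∪ Set.Ico a b := by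
    ext x
    simp only [Set.mem_inter_iff, Set.mem_Ici, Set.mem_union, Set.mem_Ico]
    constructor
    · rintro ⟨hx, hax⟩
      rcases lt_or_ge x b with hxb | hxb
      · exact Or.inr ⟨hax, hxb⟩
      · exact Or.inl ⟨hx, hxb⟩
    · rintro (⟨hx, hbx⟩ | hx)
      · exact ⟨hx, by omega⟩
      · exact ⟨h hx, hx.1⟩
  rw [heq, Set.ncard_union_eq _ hfin (Set.finite_Ico a b)]
  · congr 1
    rw [← Finset.coe_Ico, Set.ncard_coe_finset, Int.card_Ico]
  · rw [Set.disjoint_left]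
    rintro x ⟨-, hx⟩ hx'
    exact absurd hx'.2 (not_lt.2 hx)

theorem ncard_inter_Iic {U : Set ℤ} {a b : ℤ} (hab : a ≤ b) (hU : BddBelow U)
    (h : Set.Ioc a b ⊆ U) :
    (U ∩ Set.Iic b).ncard = (U ∩ Set.Iic a).ncard + (b - a).toNat := by
  have hfin : (U ∩ Set.Iic a).Finite := by
    obtain ⟨c, hc⟩ := hU
    exact (Set.finite_Icc c a).subset fun x hx => ⟨hc hx.1, hx.2⟩
  have heq : U ∩ Set.Iic b = (U ∩ Set.Iic a) ∪ Set.Ioc a b := by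
    ext x
    simp only [Set.mem_inter_iff, Set.mem_Iic, Set.mem_union, Set.mem_Ioc]
    constructor
    · rintro ⟨hx, hxb⟩
      rcases lt_or_ge a x with hxa | hxa
      · exact Or.inr ⟨hxa, hxb⟩
      · exact Or.inl ⟨hx, hxa⟩
    · rintro (⟨hx, hxa⟩ | hx)
      · exact ⟨hx, by omega⟩
      · exact ⟨h hx, hx.2⟩
  rw [heq, Set.ncard_union_eq _ hfin (Set.finite_Ioc a b)]
  · congr 1
    rw [← Finset.coe_Ioc, Set.ncard_coe_finset, Int.card_Ioc]
  · rw [Set.disjoint_left]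
    rintro x ⟨-, hx⟩ hx'
    exact absurd hx'.1 (not_lt.2 hx)

/-- The displacement of the left end of the closure when `Λ` is enlarged to `Δ`. -/
def leftShift (Λ Δ : Finset ℤ) : ℕ :=
  (sInf (graphClosure (Λ : Set ℤ)) - sInf (graphClosure (Δ : Set ℤ))).toNat

/-- The displacement of the right end of the closure when `Λ` is enlarged to `Δ`. -/
def rightShift (Λ Δ : Finset ℤ) : ℕ :=
  (sSup (graphClosure (Δ : Set ℤ)) - sSup (graphClosure (Λ : Set ℤ))).toNat

open Classical in
/-- The factor by which the partition function of a component near `Λ` changes when `Λ` is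
enlarged to `Δ`. -/
def componentShift (p : ℝ) (Λ Δ : Finset ℤ) (U : Set ℤ) : ℝ :=
  (if BddBelow U then 1 else eigenvaluePF p ^ leftShift Λ Δ) *
    (if BddAbove U then 1 else eigenvaluePF p ^ rightShift Λ Δ)

/-- Only infinite components see the volume, namely through the point from which their sites are
counted. Enlarging `Λ` moves that point through sites of the component itself. -/
theorem componentZ_eq_mul_componentShift (p : ℝ) {Λ Δ : Finset ℤ} (h : Λ ⊆ Δ) {ω : Config}
    {U : Set ℤ} (hU : U ∈ unfixedNear Λ ω) :
    componentZ p Δ U = componentZ p Λ U * componentShift p Λ Δ U := by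
  obtain ⟨hUc, x, hx, y, hy, hxy⟩ := hU
  obtain ⟨-, hord, -, -⟩ := mem_components_iff.1 hUc
  have hsub : graphClosure (Λ : Set ℤ) ⊆ graphClosure (Δ : Set ℤ) :=
    graphClosure_mono (by exact_mod_cast h)
  have hm : sInf (graphClosure (Δ : Set ℤ)) ≤ sInf (graphClosure (Λ : Set ℤ)) :=
    csInf_le_csInf (graphClosure_finite Δ).bddBelow ⟨x, hx⟩ hsub
  have hM : sSup (graphClosure (Λ : Set ℤ)) ≤ sSup (graphClosure (Δ : Set ℤ)) :=
    csSup_le_csSup (graphClosure_finite Δ).bddAbove ⟨x, hx⟩ hsub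
  have hxI := graphClosure_subset_Icc Λ hx
  obtain ⟨hmx, hxM⟩ := hxI
  rw [abs_le] at hxy
  unfold componentZ componentShift rightRay leftRay leftShift rightShift
  generalize sInf (graphClosure (Λ : Set ℤ)) = m at *
  generalize sSup (graphClosure (Λ : Set ℤ)) = M at *
  generalize sInf (graphClosure (Δ : Set ℤ)) = m' at *
  generalize sSup (graphClosure (Δ : Set ℤ)) = M' at *
  by_cases hf : U.Finite
  · simp [hf, hf.bddBelow, hf.bddAbove]
  by_cases ha : BddAbove U
  · have hb : ¬ BddBelow U := fun hb => hf (hb.finite_of_bddAbove ha)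
    -- All sites between the old and new left ends lie in `U`: it is unbounded below and contains
    -- `y`, which is at least `m - 1`.
    have := ncard_inter_Ici hm ha fun z hz => mem_of_not_bddBelow hord hb hy
      (by have := hz.2; omega)
    simp only [hf, ha, hb, if_true, if_false, this, pow_add]
    ring
  by_cases hb : BddBelow U
  · have := ncard_inter_Iic hM hb fun z hz => mem_of_not_bddAbove hord ha hy
      (by have := hz.1; omega)
    simp only [hf, ha, hb, if_true, if_false, this, pow_add]
    ring
  · have hc : (Set.Ici m' ∩ Set.Iic M').ncard =
        (Set.Ici m ∩ Set.Iic M).ncard + (m - m').toNat + (M' - M).toNat := by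
      rw [Set.Ici_inter_Iic, Set.Ici_inter_Iic, ← Finset.coe_Icc, ← Finset.coe_Icc,
        Set.ncard_coe_finset, Set.ncard_coe_finset, Int.card_Icc, Int.card_Icc]
      omega
    simp only [hf, ha, hb, if_false, hc, pow_add]
    ring

theorem sInf_graphClosure_mem {Λ : Finset ℤ} (h : (graphClosure (Λ : Set ℤ)).Nonempty) :
    sInf (graphClosure (Λ : Set ℤ)) ∈ graphClosure (Λ : Set ℤ) :=
  h.csInf_mem (graphClosure_finite Λ)

theorem sSup_graphClosure_mem {Λ : Finset ℤ} (h : (graphClosure (Λ : Set ℤ)).Nonempty) :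
    sSup (graphClosure (Λ : Set ℤ)) ∈ graphClosure (Λ : Set ℤ) :=
  h.csSup_mem (graphClosure_finite Λ)

/-- Whether some component near `Λ` extends to `-∞` does not depend on the spins in `Λ`. -/
theorem exists_not_bddBelow_congr {Λ : Finset ℤ} {ω η : Config} (h : ∀ i ∉ Λ, ω i = η i)
    (hω : ∃ U ∈ unfixedNear Λ ω, ¬ BddBelow U) : ∃ U ∈ unfixedNear Λ η, ¬ BddBelow U := by
  obtain ⟨U, ⟨hU, x, hx, y, hy, hxy⟩, hb⟩ := hω
  obtain ⟨-, hord, hsub, -⟩ := mem_components_iff.1 hU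
  set m := sInf (graphClosure (Λ : Set ℤ)) with hmdef
  have hmx := (graphClosure_subset_Icc Λ hx).1
  rw [abs_le] at hxy
  -- `U` reaches `-∞` and contains some `y ≥ m - 1`, so it contains all of `(-∞, m - 1]`. This
  -- half-line avoids the closure of `Λ`, hence is unfixed for `η` too.
  have hη : Set.Iic (m - 1) ⊆ (fixedArea η)ᶜ := by
    intro z hz
    have hz' : z ≤ m - 1 := hz
    have hzΛ : z ∉ graphClosure (Λ : Set ℤ) := fun hz' => by
      have h1 := (graphClosure_subset_Icc Λ hz').1
      omega
    exact (not_congr (fixedArea_congr_of_off h hzΛ)).1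
      (hsub (mem_of_not_bddBelow hord hb hy (by omega)))
  refine ⟨_, ⟨ordConnectedComponent_mem_components (hη Set.self_mem_Iic), m,
    sInf_graphClosure_mem ⟨x, hx⟩, m - 1, by simpa using hη Set.self_mem_Iic, by simp⟩, ?_⟩
  intro hb'
  refine not_bddBelow_Iic (m - 1) (hb'.mono ?_)
  exact Set.subset_ordConnectedComponent Set.self_mem_Iic hη

theorem exists_not_bddAbove_congr {Λ : Finset ℤ} {ω η : Config} (h : ∀ i ∉ Λ, ω i = η i)
    (hω : ∃ U ∈ unfixedNear Λ ω, ¬ BddAbove U) : ∃ U ∈ unfixedNear Λ η, ¬ BddAbove U := by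
  obtain ⟨U, ⟨hU, x, hx, y, hy, hxy⟩, hb⟩ := hω
  obtain ⟨-, hord, hsub, -⟩ := mem_components_iff.1 hU
  set M := sSup (graphClosure (Λ : Set ℤ)) with hMdef
  have hmx := (graphClosure_subset_Icc Λ hx).2
  rw [abs_le] at hxy
  have hη : Set.Ici (M + 1) ⊆ (fixedArea η)ᶜ := by
    intro z hz
    have hz' : M + 1 ≤ z := hz
    have hzΛ : z ∉ graphClosure (Λ : Set ℤ) := fun hz' => by
      have h1 := (graphClosure_subset_Icc Λ hz').2
      omega
    exact (not_congr (fixedArea_congr_of_off h hzΛ)).1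
      (hsub (mem_of_not_bddAbove hord hb hy (by omega)))
  refine ⟨_, ⟨ordConnectedComponent_mem_components (hη Set.self_mem_Ici), M,
    sSup_graphClosure_mem ⟨x, hx⟩, M + 1, by simpa using hη Set.self_mem_Ici, by simp⟩, ?_⟩
  intro hb'
  refine not_bddAbove_Ici (M + 1) (hb'.mono ?_)
  exact Set.subset_ordConnectedComponent Set.self_mem_Ici hη

/-- A product over a finite set with at most one non-trivial factor, equal to `c`. -/
theorem prod_ite_eq_of_unique {α : Type*} (s : Finset α) (P : α → Prop) [DecidablePred P]
    [Decidable (∃ a ∈ s, ¬ P a)] (c : ℝ)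
    (hs : ∀ a ∈ s, ∀ b ∈ s, ¬ P a → ¬ P b → a = b) :
    ∏ a ∈ s, (if P a then 1 else c) = if ∃ a ∈ s, ¬ P a then c else 1 := by
  split_ifs with h
  · obtain ⟨a, ha, hPa⟩ := h
    rw [Finset.prod_eq_single_of_mem a ha fun b hb hba => if_pos ?_, if_neg hPa]
    by_contra hPb
    exact hba (hs b hb a ha hPb hPa)
  · push Not at h
    exact Finset.prod_eq_one fun a ha => if_pos (h a ha)

/-- Two components unbounded on the same side intersect and hence coincide, so each side contributes
at most one non-trivial factor, and its presence is decided off `Λ`. -/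
theorem prod_componentShift_congr (p : ℝ) (Λ Δ : Finset ℤ) {ω η : Config}
    (h : ∀ i ∉ Λ, ω i = η i) :
    ∏ U ∈ (unfixedNear_finite Λ ω).toFinset, componentShift p Λ Δ U =
      ∏ U ∈ (unfixedNear_finite Λ η).toFinset, componentShift p Λ Δ U := by
  classical
  have h' : ∀ i ∉ Λ, η i = ω i := fun i hi => (h i hi).symm
  have hL : ∀ ω : Config, ∀ U ∈ (unfixedNear_finite Λ ω).toFinset,
      ∀ V ∈ (unfixedNear_finite Λ ω).toFinset, ¬ BddBelow U → ¬ BddBelow V → U = V := by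
    intro ω U hU V hV hbU hbV
    rw [Set.Finite.mem_toFinset] at hU hV
    obtain ⟨⟨x, hx⟩, hUo, -, -⟩ := mem_components_iff.1 hU.1
    obtain ⟨⟨y, hy⟩, hVo, -, -⟩ := mem_components_iff.1 hV.1
    exact components_eq_of_mem hU.1 hV.1 (mem_of_not_bddBelow hUo hbU hx (min_le_left x y))
      (mem_of_not_bddBelow hVo hbV hy (min_le_right x y))
  have hR : ∀ ω : Config, ∀ U ∈ (unfixedNear_finite Λ ω).toFinset,
      ∀ V ∈ (unfixedNear_finite Λ ω).toFinset, ¬ BddAbove U → ¬ BddAbove V → U = V := by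
    intro ω U hU V hV hbU hbV
    rw [Set.Finite.mem_toFinset] at hU hV
    obtain ⟨⟨x, hx⟩, hUo, -, -⟩ := mem_components_iff.1 hU.1
    obtain ⟨⟨y, hy⟩, hVo, -, -⟩ := mem_components_iff.1 hV.1
    exact components_eq_of_mem hU.1 hV.1 (mem_of_not_bddAbove hUo hbU hx (le_max_left x y))
      (mem_of_not_bddAbove hVo hbV hy (le_max_right x y))
  have eL : (∃ U ∈ (unfixedNear_finite Λ ω).toFinset, ¬ BddBelow U) ↔
      ∃ U ∈ (unfixedNear_finite Λ η).toFinset, ¬ BddBelow U := by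
    simp only [Set.Finite.mem_toFinset]
    exact ⟨exists_not_bddBelow_congr h, exists_not_bddBelow_congr h'⟩
  have eR : (∃ U ∈ (unfixedNear_finite Λ ω).toFinset, ¬ BddAbove U) ↔
      ∃ U ∈ (unfixedNear_finite Λ η).toFinset, ¬ BddAbove U := by
    simp only [Set.Finite.mem_toFinset]
    exact ⟨exists_not_bddAbove_congr h, exists_not_bddAbove_congr h'⟩
  simp only [componentShift, Finset.prod_mul_distrib]
  rw [prod_ite_eq_of_unique _ _ _ (hL ω), prod_ite_eq_of_unique _ _ _ (hR ω),
    prod_ite_eq_of_unique _ _ _ (hL η), prod_ite_eq_of_unique _ _ _ (hR η)]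
  simp only [eL, eR]

/-- The factor by which the weight changes when `Λ` is enlarged to `Δ`. -/
def weightRatio (p : ℝ) (Λ Δ : Finset ℤ) (ω : Config) : ℝ :=
  p ^ (occupied ω ∩ (graphClosure (Δ : Set ℤ) \ graphClosure (Λ : Set ℤ))).ncard *
    (1 - p) ^ (outerBoundary (occupied ω) ∩
      (graphClosure (Δ : Set ℤ) \ graphClosure (Λ : Set ℤ))).ncard *
    (∏ U ∈ ((unfixedNear_finite Δ ω).subset
      (Set.sdiff_subset (t := unfixedNear Λ ω))).toFinset, componentZ p Δ U) *
    ∏ U ∈ (unfixedNear_finite Λ ω).toFinset, componentShift p Λ Δ U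

theorem ncard_inter_eq_add {S A B : Set ℤ} (h : A ⊆ B) (hB : B.Finite) :
    (S ∩ B).ncard = (S ∩ A).ncard + (S ∩ (B \ A)).ncard := by
  rw [← Set.ncard_union_eq _ ((hB.subset h).inter_of_right S) (hB.sdiff.inter_of_right S),
    ← Set.inter_union_distrib_left, Set.union_sdiff_cancel h]
  exact Set.disjoint_left.2 fun x hx hx' => hx'.2.2 hx.2

theorem weight_eq_mul_weightRatio (p : ℝ) {Λ Δ : Finset ℤ} (h : Λ ⊆ Δ) (ω : Config) :
    weight p Δ ω = weight p Λ ω * weightRatio p Λ Δ ω := by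
  classical
  have hsub : graphClosure (Λ : Set ℤ) ⊆ graphClosure (Δ : Set ℤ) :=
    graphClosure_mono (by exact_mod_cast h)
  have hprod : ∏ U ∈ (unfixedNear_finite Δ ω).toFinset, componentZ p Δ U =
      (∏ U ∈ ((unfixedNear_finite Δ ω).subset
        (Set.sdiff_subset (t := unfixedNear Λ ω))).toFinset, componentZ p Δ U) *
      ((∏ U ∈ (unfixedNear_finite Λ ω).toFinset, componentZ p Λ U) *
        ∏ U ∈ (unfixedNear_finite Λ ω).toFinset, componentShift p Λ Δ U) := by
    rw [← Finset.prod_mul_distrib, ← Finset.prod_sdiff (s₁ := (unfixedNear_finite Λ ω).toFinset)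
      (s₂ := (unfixedNear_finite Δ ω).toFinset)
      (Set.Finite.toFinset_subset_toFinset.2 (unfixedNear_mono h ω))]
    congr 1
    · refine Finset.prod_congr ?_ fun _ _ => rfl
      ext U
      simp
    · refine Finset.prod_congr rfl fun U hU => ?_
      exact componentZ_eq_mul_componentShift p h ((Set.Finite.mem_toFinset _).1 hU)
  unfold weight weightRatio
  rw [hprod, ncard_inter_eq_add hsub (graphClosure_finite Δ),
    ncard_inter_eq_add (S := outerBoundary (occupied ω)) hsub (graphClosure_finite Δ)]
  ring

/-- Each factor looks outside the closure of `Λ`, at components not near `Λ`, or at the existence of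
infinite components near `Λ`. None of these depends on the spins in `Λ`. -/
theorem weightRatio_congr (p : ℝ) (Λ Δ : Finset ℤ) {ω η : Config} (h : ∀ i ∉ Λ, ω i = η i) :
    weightRatio p Λ Δ ω = weightRatio p Λ Δ η := by
  have hsub : ∀ x ∉ graphClosure (Λ : Set ℤ), ω x = η x := fun x hx =>
    h x fun hx' => hx (Or.inl hx')
  have e1 : occupied ω ∩ (graphClosure (Δ : Set ℤ) \ graphClosure (Λ : Set ℤ)) =
      occupied η ∩ (graphClosure (Δ : Set ℤ) \ graphClosure (Λ : Set ℤ)) := by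
    ext x
    refine and_congr_left fun hx => ?_
    change ω x = true ↔ η x = true
    rw [hsub x hx.2]
  have e2 : outerBoundary (occupied ω) ∩ (graphClosure (Δ : Set ℤ) \ graphClosure (Λ : Set ℤ)) =
      outerBoundary (occupied η) ∩ (graphClosure (Δ : Set ℤ) \ graphClosure (Λ : Set ℤ)) := by
    ext x
    refine and_congr_left fun hx => ?_
    rw [mem_outerBoundary_occupied, mem_outerBoundary_occupied, hsub x hx.2,
      fixedArea_congr_of_off h hx.2]
  unfold weightRatio
  rw [e1, e2, prod_componentShift_congr p Λ Δ h]
  congr 2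
  refine Finset.prod_congr ?_ fun _ _ => rfl
  rw [Set.Finite.toFinset_inj]
  exact unfixedNear_diff_congr h

/-- The detailed balance relation between the weights of two volumes. -/
theorem weight_mul_weight_comm (p : ℝ) {Λ Δ : Finset ℤ} (hΛΔ : Λ ⊆ Δ) {ω η : Config}
    (h : ∀ i ∉ Λ, ω i = η i) :
    weight p Δ ω * weight p Λ η = weight p Δ η * weight p Λ ω := by
  rw [weight_eq_mul_weightRatio p hΛΔ, weight_eq_mul_weightRatio p hΛΔ η,
    weightRatio_congr p Λ Δ h]
  ring

/-! ### Positivity of the weights -/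

theorem eigenvaluePF_pos {p : ℝ} (hp1 : p < 1) : 0 < eigenvaluePF p := by
  have h1 : 0 < 1 - p := by linarith
  unfold eigenvaluePF
  positivity

/-- Cayley–Hamilton: `Q` has trace `1 - p` and determinant `-p(1 - p)`. -/
theorem transferMatrix_pow_add_two {p : ℝ} (hp0 : 0 ≤ p) (hp1 : p ≤ 1) (n : ℕ) :
    (transferMatrix p ^ (n + 2)) 0 0 =
      (1 - p) * (transferMatrix p ^ (n + 1)) 0 0 + p * (1 - p) * (transferMatrix p ^ n) 0 0 := by
  have hs : √(p * (1 - p)) * √(p * (1 - p)) = p * (1 - p) :=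
    Real.mul_self_sqrt (mul_nonneg hp0 (by linarith))
  have hQ : transferMatrix p ^ 2 = (1 - p) • transferMatrix p + (p * (1 - p)) • 1 := by
    ext i j
    fin_cases i <;> fin_cases j <;>
      simp [transferMatrix, pow_two, Matrix.mul_apply, Fin.sum_univ_two, hs] <;> ring
  rw [pow_add, hQ, mul_add, Matrix.mul_smul, Matrix.mul_smul, mul_one, ← pow_succ]
  simp

theorem transferMatrix_pow_pos {p : ℝ} (hp0 : 0 ≤ p) (hp1 : p < 1) (n : ℕ) :
    0 < (transferMatrix p ^ n) 0 0 := by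
  induction n using Nat.strong_induction_on with
  | _ n ih =>
    match n with
    | 0 => simp
    | 1 => simpa [transferMatrix] using hp1
    | n + 2 =>
      rw [transferMatrix_pow_add_two hp0 hp1.le]
      have h1 := ih (n + 1) (by omega)
      have h2 := ih n (by omega)
      have h3 : 0 < 1 - p := by linarith
      positivity

theorem componentZ_pos {p : ℝ} (hp0 : 0 ≤ p) (hp1 : p < 1) (Λ : Finset ℤ) (U : Set ℤ) :
    0 < componentZ p Λ U := by
  have h1 : 0 < 1 - p := by linarith
  have hl := eigenvaluePF_pos hp1
  have hQ := transferMatrix_pow_pos hp0 hp1 (U.ncard + 1)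
  unfold componentZ constD
  split_ifs <;> positivity

theorem weight_pos {p : ℝ} (hp0 : 0 < p) (hp1 : p < 1) (Λ : Finset ℤ) (ω : Config) :
    0 < weight p Λ ω := by
  have h1 : 0 < 1 - p := by linarith
  have h2 := Finset.prod_pos fun U (_ : U ∈ (unfixedNear_finite Λ ω).toFinset) =>
    componentZ_pos hp0.le hp1 Λ U
  unfold weight
  positivity

/-! ### Measurability of the weights -/

theorem mem_nonIsolated_iff {ω : Config} :
    ω ∈ nonIsolated ↔ ∀ i, ω i = true → ω (i - 1) = true ∨ ω (i + 1) = true := by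
  constructor
  · rintro ⟨η, rfl⟩ i hi
    have key : ∀ j, thin η j = true ↔ η j = true ∧ (η (j - 1) = true ∨ η (j + 1) = true) := by
      intro j
      unfold thin
      cases η j <;> cases η (j - 1) <;> cases η (j + 1) <;> simp
    rw [key] at hi
    rw [key, key]
    rcases hi with ⟨h0, h | h⟩
    · exact Or.inl ⟨h, Or.inr (by simpa using h0)⟩
    · exact Or.inr ⟨h, Or.inl (by simpa using h0)⟩
  · intro h
    refine ⟨ω, funext fun i => ?_⟩
    have := h i
    unfold thin
    cases h0 : ω i <;> simp_all

theorem thin_eq_true_iff {ω : Config} {i : ℤ} :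
    thin ω i = true ↔ ω i = true ∧ (ω (i - 1) = true ∨ ω (i + 1) = true) := by
  unfold thin
  cases ω i <;> cases ω (i - 1) <;> cases ω (i + 1) <;> simp

theorem thin_eq_self {ω : Config} (h : ω ∈ nonIsolated) : thin ω = ω := by
  funext i
  have := mem_nonIsolated_iff.1 h i
  rw [Bool.eq_iff_iff, thin_eq_true_iff]
  tauto

theorem thinMap_coe (ω : NonIsolated) : thinMap ω = ω := Subtype.ext (thin_eq_self ω.2)

theorem measurableSet_spin (i : ℤ) (b : Bool) : MeasurableSet {ω : Config | ω i = b} :=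
  (measurable_pi_apply i : Measurable fun ω : Config => ω i) (measurableSet_singleton b)

theorem measurableSet_nonIsolated : MeasurableSet nonIsolated := by
  have : nonIsolated = ⋂ i : ℤ, ({ω : Config | ω i = true}ᶜ ∪
      ({ω : Config | ω (i - 1) = true} ∪ {ω : Config | ω (i + 1) = true})) := by
    ext ω
    simp only [mem_nonIsolated_iff, Set.mem_iInter, Set.mem_union, Set.mem_compl_iff,
      Set.mem_ofPred_eq, imp_iff_not_or]
  rw [this]
  exact MeasurableSet.iInter fun i => (measurableSet_spin i true).compl.union
    ((measurableSet_spin _ true).union (measurableSet_spin _ true))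

theorem measurableSet_mem_fixedArea (x : ℤ) : MeasurableSet {ω : Config | x ∈ fixedArea ω} := by
  simp only [mem_fixedArea]
  exact (measurableSet_spin _ true).union
    ((measurableSet_spin _ true).union (measurableSet_spin _ true))

/-- An interval of `ℤ` is coded by its two optional end points, an absent one meaning unbounded on
that side. -/
theorem countable_setOf_ordConnected : {U : Set ℤ | U.OrdConnected}.Countable := by
  have key : {U : Set ℤ | U.OrdConnected} ⊆ Set.range fun q : Option ℤ × Option ℤ =>
      {x : ℤ | (∀ a ∈ q.1, a ≤ x) ∧ ∀ b ∈ q.2, x ≤ b} := by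
    intro U hU
    have hU' : U.OrdConnected := hU
    rcases U.eq_empty_or_nonempty with rfl | hne
    · refine ⟨(some 1, some 0), ?_⟩
      ext x
      simp
      omega
    obtain ⟨y, hy⟩ := hne
    have hleft : ∃ q : Option ℤ, ∀ x ≤ y, (∀ a ∈ q, a ≤ x) ↔ x ∈ U := by
      by_cases hb : BddBelow U
      · refine ⟨some (sInf U), fun x hxy => ?_⟩
        simp only [Option.mem_def, Option.some.injEq, forall_eq']
        exact ⟨fun h => hU'.out (Int.csInf_mem ⟨y, hy⟩ hb) hy ⟨h, hxy⟩, fun h => csInf_le hb h⟩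
      · exact ⟨none, fun x hxy => by simpa using mem_of_not_bddBelow hU' hb hy hxy⟩
    have hright : ∃ q : Option ℤ, ∀ x ≥ y, (∀ a ∈ q, x ≤ a) ↔ x ∈ U := by
      by_cases hb : BddAbove U
      · refine ⟨some (sSup U), fun x hxy => ?_⟩
        simp only [Option.mem_def, Option.some.injEq, forall_eq']
        exact ⟨fun h => hU'.out hy (Int.csSup_mem ⟨y, hy⟩ hb) ⟨hxy, h⟩, fun h => le_csSup hb h⟩
      · exact ⟨none, fun x hxy => by simpa using mem_of_not_bddAbove hU' hb hy hxy⟩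
    obtain ⟨q₁, h₁⟩ := hleft
    obtain ⟨q₂, h₂⟩ := hright
    refine ⟨(q₁, q₂), ?_⟩
    ext x
    have e₁ := (h₁ y le_rfl).2 hy
    have e₂ := (h₂ y le_rfl).2 hy
    rcases le_total x y with hxy | hxy
    · exact ⟨fun h => (h₁ x hxy).1 h.1,
        fun h => ⟨(h₁ x hxy).2 h, fun b hb => hxy.trans (e₂ b hb)⟩⟩
    · exact ⟨fun h => (h₂ x hxy).1 h.2,
        fun h => ⟨fun b hb => (e₁ b hb).trans hxy, (h₂ x hxy).2 h⟩⟩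
  exact (Set.countable_range _).mono key

theorem measurableSet_mem_unfixed (U : Set ℤ) : MeasurableSet {ω : Config | U ∈ unfixed ω} := by
  have h1 : MeasurableSet (⋂ x ∈ U, {ω : Config | x ∈ fixedArea ω}ᶜ) :=
    MeasurableSet.biInter (Set.to_countable U) fun x _ => (measurableSet_mem_fixedArea x).compl
  have h2 : MeasurableSet (⋂ x ∈ U, ⋂ y : ℤ,
      {ω : Config | y ∈ fixedArea ω} ∪ {_ω : Config | |x - y| ≤ 1 → y ∈ U}) :=
    MeasurableSet.biInter (Set.to_countable U) fun x _ => MeasurableSet.iInter fun y =>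
      (measurableSet_mem_fixedArea y).union (MeasurableSet.const _)
  have heq : {ω : Config | U ∈ unfixed ω} = {_ω : Config | U.Nonempty} ∩
      ({_ω : Config | U.OrdConnected} ∩ ((⋂ x ∈ U, {ω : Config | x ∈ fixedArea ω}ᶜ) ∩
        ⋂ x ∈ U, ⋂ y : ℤ,
          {ω : Config | y ∈ fixedArea ω} ∪ {_ω : Config | |x - y| ≤ 1 → y ∈ U})) := by
    ext ω
    simp only [unfixed, mem_components_iff, Set.mem_ofPred_eq, Set.mem_iInter, Set.mem_compl_iff,
      Set.mem_union, Set.mem_inter_iff, Set.subset_def]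
    refine and_congr_right fun _ => and_congr_right fun _ => and_congr_right fun _ =>
      forall₂_congr fun x _ => forall_congr' fun y => ?_
    tauto
  rw [heq]
  exact (MeasurableSet.const _).inter ((MeasurableSet.const _).inter (h1.inter h2))

/-- A function of the set of components near `Λ` is measurable. -/
theorem measurable_comp_unfixedNear (Λ : Finset ℤ) (g : Set (Set ℤ) → ℝ) :
    Measurable fun ω : Config => g (unfixedNear Λ ω) := by
  set K : Set (Set ℤ) := {U | U.OrdConnected} with hK
  have hKc : K.Countable := countable_setOf_ordConnected
  -- There are countably many intervals, hence countably many finite families of them. The set of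
  -- nearby components is thus a discrete random variable, and every `g` is allowed.
  have hFc : {F : Set (Set ℤ) | F.Finite ∧ F ⊆ K}.Countable := Set.countable_ofPred_finite_subset hKc
  have hmem : ∀ ω : Config, unfixedNear Λ ω ∈ {F : Set (Set ℤ) | F.Finite ∧ F ⊆ K} := fun ω =>
    ⟨unfixedNear_finite Λ ω, fun U hU => (mem_components_iff.1 hU.1).2.1⟩
  intro t _
  have hpre : (fun ω : Config => g (unfixedNear Λ ω)) ⁻¹' t =
      ⋃ F ∈ {F : Set (Set ℤ) | F.Finite ∧ F ⊆ K} ∩ g ⁻¹' t, {ω : Config | unfixedNear Λ ω = F} := by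
    ext ω
    simp only [Set.mem_iUnion, Set.mem_preimage, Set.mem_inter_iff, exists_prop]
    constructor
    · intro h
      exact ⟨_, ⟨hmem ω, h⟩, rfl⟩
    · rintro ⟨F, ⟨-, hF⟩, h⟩
      have h' : unfixedNear Λ ω = F := h
      rwa [h']
  rw [hpre]
  refine MeasurableSet.biUnion (hFc.mono Set.inter_subset_left) ?_
  rintro F ⟨⟨-, hF⟩, -⟩
  have heq : {ω : Config | unfixedNear Λ ω = F} =
      ⋂ U ∈ K, {ω : Config | U ∈ unfixedNear Λ ω ↔ U ∈ F} := by
    ext ω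
    simp only [Set.mem_iInter, Set.mem_ofPred_eq]
    constructor
    · rintro rfl U _
      rfl
    · intro h
      ext U
      by_cases hU : U ∈ K
      · exact h U hU
      · exact ⟨fun h' => (hU ((hmem ω).2 h')).elim, fun h' => (hU (hF h')).elim⟩
  rw [heq]
  refine MeasurableSet.biInter hKc fun U _ => ?_
  have hU : MeasurableSet {ω : Config | U ∈ unfixedNear Λ ω} :=
    (measurableSet_mem_unfixed U).inter (MeasurableSet.const _)
  by_cases hUF : U ∈ F
  · simpa only [hUF, iff_true] using hU
  · simp only [hUF, iff_false]
    exact hU.compl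

theorem measurable_ncard_inter {S : Config → Set ℤ} (hS : ∀ x, MeasurableSet {ω | x ∈ S ω})
    {C : Set ℤ} (hC : C.Finite) : Measurable fun ω => (S ω ∩ C).ncard := by
  classical
  have : (fun ω => (S ω ∩ C).ncard) =
      fun ω => ∑ x ∈ hC.toFinset, if x ∈ S ω then 1 else 0 := by
    funext ω
    rw [← Finset.sum_filter, Finset.sum_const, smul_eq_mul, mul_one, ← Set.ncard_coe_finset]
    congr 1
    ext x
    simp [and_comm]
  rw [this]
  exact Finset.measurable_sum _ fun x _ => Measurable.ite (hS x) measurable_const measurable_const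

theorem measurable_weight (p : ℝ) (Λ : Finset ℤ) : Measurable (weight p Λ) := by
  classical
  refine Measurable.mul (Measurable.mul ?_ ?_) ?_
  · exact (measurable_of_countable fun n : ℕ => p ^ n).comp
      (measurable_ncard_inter (fun x => measurableSet_spin x true) (graphClosure_finite Λ))
  · refine (measurable_of_countable fun n : ℕ => (1 - p) ^ n).comp
      (measurable_ncard_inter (fun x => ?_) (graphClosure_finite Λ))
    simp only [mem_outerBoundary_occupied]
    exact (measurableSet_spin x false).inter (measurableSet_mem_fixedArea x)
  -- The `finprod` makes the product a function of the family alone, free of the finiteness proof,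
  -- which depends on the configuration.
  · have := measurable_comp_unfixedNear Λ fun F => ∏ᶠ U ∈ F, componentZ p Λ U
    simpa only [finprod_mem_eq_finite_toFinset_prod _ (unfixedNear_finite Λ _)] using this

/-! ### Spins off a finite set -/

theorem spinSigma_le (S : Set ℤ) : spinSigma S ≤ (inferInstance : MeasurableSpace Config) :=
  iSup₂_le fun i _ => (measurable_pi_apply (X := fun _ : ℤ => Bool) i).comap_le

theorem measurableSet_spinSigma {S : Set ℤ} {i : ℤ} (hi : i ∈ S) (b : Bool) :
    MeasurableSet[spinSigma S] {ω : Config | ω i = b} :=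
  (le_iSup₂_of_le (f := fun i (_ : i ∈ S) =>
    MeasurableSpace.comap (fun ω : Config => ω i) inferInstance) i hi le_rfl) _
    ⟨{b}, measurableSet_singleton b, rfl⟩

theorem mem_congr_of_measurableSet_spinSigma {S : Set ℤ} {A : Set Config}
    (hA : MeasurableSet[spinSigma S] A) {ω η : Config} (h : ∀ i ∈ S, ω i = η i) :
    ω ∈ A ↔ η ∈ A := by
  have hle : spinSigma S ≤ MeasurableSpace.comap (fun (ω : Config) (i : S) => ω i)
      (inferInstance : MeasurableSpace (S → Bool)) := by
    refine iSup₂_le fun i hi => ?_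
    rintro _ ⟨t, ht, rfl⟩
    exact ⟨(fun ξ : S → Bool => ξ ⟨i, hi⟩) ⁻¹' t, measurable_pi_apply _ ht, rfl⟩
  obtain ⟨B, -, rfl⟩ := hle _ hA
  have : (fun i : S => ω i) = fun i : S => η i := funext fun i => h i i.2
  simp only [Set.mem_preimage, this]

theorem glue_of_mem {Λ : Finset ℤ} {ζ : Λ → Bool} {ω : Config} {i : ℤ} (h : i ∈ Λ) :
    glue Λ ζ ω i = ζ ⟨i, h⟩ := dif_pos h

theorem glue_of_notMem {Λ : Finset ℤ} {ζ : Λ → Bool} {ω : Config} {i : ℤ} (h : i ∉ Λ) :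
    glue Λ ζ ω i = ω i := dif_neg h

theorem glue_self (Λ : Finset ℤ) (ω : Config) : glue Λ (fun i => ω i) ω = ω := by
  funext i
  by_cases h : i ∈ Λ
  · rw [glue_of_mem h]
  · rw [glue_of_notMem h]

theorem glue_congr {Λ : Finset ℤ} {ζ : Λ → Bool} {ω η : Config} (h : ∀ i ∉ Λ, ω i = η i) :
    glue Λ ζ ω = glue Λ ζ η := by
  funext i
  by_cases hi : i ∈ Λ
  · rw [glue_of_mem hi, glue_of_mem hi]
  · rw [glue_of_notMem hi, glue_of_notMem hi, h i hi]

theorem measurable_glue (Λ : Finset ℤ) (ζ : Λ → Bool) :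
    Measurable[spinSigma (Λ : Set ℤ)ᶜ] (glue Λ ζ) := by
  refine @measurable_pi_lambda _ _ _ (spinSigma (Λ : Set ℤ)ᶜ) _ _ fun i => ?_
  by_cases hi : i ∈ Λ
  · have : (fun ω : Config => glue Λ ζ ω i) = fun _ => ζ ⟨i, hi⟩ := by
      funext ω
      exact glue_of_mem hi
    rw [this]
    exact measurable_const
  · have : (fun ω : Config => glue Λ ζ ω i) = fun ω => ω i := by
      funext ω
      exact glue_of_notMem hi
    rw [this]
    refine Measurable.mono (comap_measurable _) ?_ le_rfl
    exact le_iSup₂_of_le (f := fun i (_ : i ∈ (Λ : Set ℤ)ᶜ) =>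
      MeasurableSpace.comap (fun ω : Config => ω i) inferInstance) i (by simpa using hi) le_rfl

/-! ### The Gibbs kernels -/

/-- The weight, set to zero on configurations with isolated occupied sites. -/
def niWeight (p : ℝ) (Λ : Finset ℤ) : Config → ℝ := nonIsolated.indicator (weight p Λ)

theorem niWeight_of_mem (p : ℝ) (Λ : Finset ℤ) {ω : Config} (h : ω ∈ nonIsolated) :
    niWeight p Λ ω = weight p Λ ω := Set.indicator_of_mem h _

theorem niWeight_of_notMem (p : ℝ) (Λ : Finset ℤ) {ω : Config} (h : ω ∉ nonIsolated) :
    niWeight p Λ ω = 0 := Set.indicator_of_notMem h _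

theorem niWeight_nonneg {p : ℝ} (hp0 : 0 < p) (hp1 : p < 1) (Λ : Finset ℤ) (ω : Config) :
    0 ≤ niWeight p Λ ω :=
  Set.indicator_nonneg (fun _ _ => (weight_pos hp0 hp1 Λ _).le) ω

theorem measurable_niWeight (p : ℝ) (Λ : Finset ℤ) : Measurable (niWeight p Λ) :=
  (measurable_weight p Λ).indicator measurableSet_nonIsolated

theorem niWeight_mul_niWeight_comm (p : ℝ) {Λ Δ : Finset ℤ} (hΛΔ : Λ ⊆ Δ) {ω η : Config}
    (h : ∀ i ∉ Λ, ω i = η i) :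
    niWeight p Δ ω * niWeight p Λ η = niWeight p Δ η * niWeight p Λ ω := by
  by_cases hω : ω ∈ nonIsolated
  · by_cases hη : η ∈ nonIsolated
    · simp only [niWeight_of_mem, hω, hη]
      exact weight_mul_weight_comm p hΛΔ h
    · simp [niWeight_of_notMem p _ hη]
  · simp [niWeight_of_notMem p _ hω]

theorem partitionZ_eq (p : ℝ) (Λ : Finset ℤ) (ω : Config) :
    partitionZ p Λ ω = ∑ ζ : Λ → Bool, niWeight p Λ (glue Λ ζ ω) := rfl

theorem partitionZ_congr (p : ℝ) {Λ : Finset ℤ} {ω η : Config} (h : ∀ i ∉ Λ, ω i = η i) :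
    partitionZ p Λ ω = partitionZ p Λ η := by
  simp only [partitionZ_eq, glue_congr h]

theorem partitionZ_pos {p : ℝ} (hp0 : 0 < p) (hp1 : p < 1) (Λ : Finset ℤ) {ω : Config}
    (hω : ω ∈ nonIsolated) : 0 < partitionZ p Λ ω := by
  rw [partitionZ_eq]
  refine Finset.sum_pos' (fun ζ _ => niWeight_nonneg hp0 hp1 Λ _)
    ⟨fun i => ω i, Finset.mem_univ _, ?_⟩
  rw [glue_self, niWeight_of_mem p Λ hω]
  exact weight_pos hp0 hp1 Λ ω

/-- The probability of the spins `ζ` in `Λ` given the configuration `ω` off `Λ`. -/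
def spinProb (p : ℝ) (Λ : Finset ℤ) (ζ : Λ → Bool) (ω : Config) : ENNReal :=
  ENNReal.ofReal (niWeight p Λ (glue Λ ζ ω) / partitionZ p Λ ω)

theorem measurable_spinProb (p : ℝ) (Λ : Finset ℤ) (ζ : Λ → Bool) :
    Measurable[spinSigma (Λ : Set ℤ)ᶜ] (spinProb p Λ ζ) := by
  have h : ∀ ζ : Λ → Bool,
      Measurable[spinSigma (Λ : Set ℤ)ᶜ] fun ω => niWeight p Λ (glue Λ ζ ω) :=
    fun ζ => (measurable_niWeight p Λ).comp (measurable_glue Λ ζ)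
  refine ENNReal.measurable_ofReal.comp (Measurable.div (h ζ) ?_)
  simp only [funext (partitionZ_eq p Λ)]
  exact Finset.measurable_sum _ fun ζ _ => h ζ

theorem sum_spinProb {p : ℝ} (hp0 : 0 < p) (hp1 : p < 1) (Λ : Finset ℤ) {ω : Config}
    (hω : ω ∈ nonIsolated) : ∑ ζ : Λ → Bool, spinProb p Λ ζ ω = 1 := by
  have hZ := partitionZ_pos hp0 hp1 Λ hω
  unfold spinProb
  rw [← ENNReal.ofReal_sum_of_nonneg fun ζ _ => div_nonneg (niWeight_nonneg hp0 hp1 Λ _) hZ.le,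
    ← Finset.sum_div, ← partitionZ_eq, div_self hZ.ne', ENNReal.ofReal_one]

theorem spinProb_eq_zero (p : ℝ) (Λ : Finset ℤ) {ζ : Λ → Bool} {ω : Config}
    (h : glue Λ ζ ω ∉ nonIsolated) : spinProb p Λ ζ ω = 0 := by
  simp [spinProb, niWeight_of_notMem p Λ h]

/-- The measure on non-isolated configurations that keeps `ω` off `Λ` and draws the spins in `Λ`
according to their weights. -/
def gibbsMeasure (p : ℝ) (Λ : Finset ℤ) (ω : Config) : Measure NonIsolated :=
  -- `thinMap` serves only to land in the subtype: it fixes non-isolated configurations, and the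
  -- others carry zero mass.
  ∑ ζ : Λ → Bool, spinProb p Λ ζ ω • Measure.dirac (thinMap (glue Λ ζ ω))

theorem gibbsMeasure_apply (p : ℝ) (Λ : Finset ℤ) (ω : Config) {A : Set NonIsolated}
    (hA : MeasurableSet A) : gibbsMeasure p Λ ω A =
      ∑ ζ : Λ → Bool, spinProb p Λ ζ ω * A.indicator 1 (thinMap (glue Λ ζ ω)) := by
  simp [gibbsMeasure, Measure.finsetSum_apply, Measure.dirac_apply' _ hA]

theorem lintegral_gibbsMeasure (p : ℝ) (Λ : Finset ℤ) (ω : Config) {f : NonIsolated → ENNReal}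
    (hf : Measurable f) : ∫⁻ η, f η ∂(gibbsMeasure p Λ ω) =
      ∑ ζ : Λ → Bool, spinProb p Λ ζ ω * f (thinMap (glue Λ ζ ω)) := by
  rw [gibbsMeasure, lintegral_finsetSum_measure]
  simp [lintegral_smul_measure, lintegral_dirac' _ hf]

theorem measurable_gibbsMeasure_apply (p : ℝ) (Λ : Finset ℤ) {A : Set NonIsolated}
    (hA : MeasurableSet A) :
    Measurable[spinSigma (Λ : Set ℤ)ᶜ] fun ω => gibbsMeasure p Λ ω A := by
  simp only [gibbsMeasure_apply p Λ _ hA]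
  refine Finset.measurable_sum _ fun ζ _ => (measurable_spinProb p Λ ζ).mul ?_
  exact (measurable_one.indicator hA).comp (measurable_thinMap.comp (measurable_glue Λ ζ))

/-- The Gibbs kernels as a kernel family. -/
def gibbsKernel (p : ℝ) : KernelFamily := fun Λ =>
  @Kernel.mk _ _ (spinSigma' (Λ : Set ℤ)ᶜ) inferInstance (fun ω => gibbsMeasure p Λ ω) <| by
    refine @Measure.measurable_of_measurable_coe _ _ _ (spinSigma' (Λ : Set ℤ)ᶜ) _ fun A hA => ?_
    exact (measurable_gibbsMeasure_apply p Λ hA).comp (comap_measurable _)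

theorem gibbsKernel_apply (p : ℝ) (Λ : Finset ℤ) (ω : NonIsolated) :
    gibbsKernel p Λ ω = gibbsMeasure p Λ ω := rfl

theorem isProbabilityMeasure_gibbsMeasure {p : ℝ} (hp0 : 0 < p) (hp1 : p < 1) (Λ : Finset ℤ)
    {ω : Config} (hω : ω ∈ nonIsolated) : IsProbabilityMeasure (gibbsMeasure p Λ ω) := by
  refine ⟨?_⟩
  rw [gibbsMeasure_apply p Λ ω MeasurableSet.univ]
  simpa using sum_spinProb hp0 hp1 Λ hω

theorem thinMap_glue_mem_iff (Λ : Finset ℤ) {ω : NonIsolated} {ζ : Λ → Bool}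
    (h : glue Λ ζ ω ∈ nonIsolated) {A : Set NonIsolated}
    (hA : MeasurableSet[spinSigma' (Λ : Set ℤ)ᶜ] A) :
    thinMap (glue Λ ζ ω) ∈ A ↔ ω ∈ A := by
  obtain ⟨B, hB, rfl⟩ := hA
  change thin (glue Λ ζ ω) ∈ B ↔ (ω : Config) ∈ B
  rw [thin_eq_self h]
  exact mem_congr_of_measurableSet_spinSigma hB fun i hi =>
    glue_of_notMem (by simpa using hi)

/-- Every configuration charged by the kernel agrees with `ω` off `Λ`, so an event off `Λ` factors
out. This yields properness and later the passage from invariance to conditional probabilities. -/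
theorem gibbsMeasure_inter {p : ℝ} (Λ : Finset ℤ) (ω : NonIsolated) {A B : Set NonIsolated}
    (hA : MeasurableSet A) (hB : MeasurableSet[spinSigma' (Λ : Set ℤ)ᶜ] B) :
    gibbsMeasure p Λ ω (A ∩ B) = B.indicator 1 ω * gibbsMeasure p Λ ω A := by
  rw [gibbsMeasure_apply p Λ _ (hA.inter (spinSigma'_le _ _ hB)), gibbsMeasure_apply p Λ _ hA,
    Finset.mul_sum]
  refine Finset.sum_congr rfl fun ζ _ => ?_
  by_cases h : glue Λ ζ ω ∈ nonIsolated
  · have := thinMap_glue_mem_iff Λ h hB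
    by_cases hω : ω ∈ B
    · simp [Set.inter_indicator_one, hω, this.2 hω]
    · simp [hω, mt this.1 hω]
  · simp [spinProb_eq_zero p Λ h]

/-- Exchange of the spins in `Λ ⊆ Δ` between a configuration in `Δ` and one in `Λ`. -/
def swapSpins {Λ Δ : Finset ℤ} (h : Λ ⊆ Δ) (q : (Δ → Bool) × (Λ → Bool)) :
    (Δ → Bool) × (Λ → Bool) :=
  (fun i => if hi : (i : ℤ) ∈ Λ then q.2 ⟨i, hi⟩ else q.1 i, fun i => q.1 ⟨i, h i.2⟩)

theorem swapSpins_involutive {Λ Δ : Finset ℤ} (h : Λ ⊆ Δ) :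
    Function.Involutive (swapSpins h) := by
  rintro ⟨ξ, ζ⟩
  refine Prod.ext (funext fun i => ?_) (funext fun i => ?_)
  · by_cases hi : (i : ℤ) ∈ Λ <;> simp [swapSpins, hi]
  · simp [swapSpins]

theorem glue_swapSpins {Λ Δ : Finset ℤ} (h : Λ ⊆ Δ) (q : (Δ → Bool) × (Λ → Bool))
    (ω : Config) : glue Δ (swapSpins h q).1 ω = glue Λ q.2 (glue Δ q.1 ω) := by
  funext i
  by_cases hi : i ∈ Λ
  · simp [glue, swapSpins, hi, h hi]
  · by_cases hi' : i ∈ Δ <;> simp [glue, swapSpins, hi, hi']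

/-- Reversibility: the swap changes the `Δ`-configuration only inside `Λ`, so both normalizations
are unchanged and the numerators are equal by detailed balance. -/
theorem spinProb_swapSpins {p : ℝ} (hp0 : 0 < p) (hp1 : p < 1) {Λ Δ : Finset ℤ} (h : Λ ⊆ Δ)
    (q : (Δ → Bool) × (Λ → Bool)) (ω : Config) (hω : ω ∈ nonIsolated) :
    spinProb p Δ (swapSpins h q).1 ω *
        spinProb p Λ (swapSpins h q).2 (glue Δ (swapSpins h q).1 ω) =
      spinProb p Δ q.1 ω * spinProb p Λ q.2 (glue Δ q.1 ω) := by
  have hback : glue Λ (swapSpins h q).2 (glue Δ (swapSpins h q).1 ω) = glue Δ q.1 ω := by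
    rw [← glue_swapSpins h, swapSpins_involutive h q]
  have hagree : ∀ i ∉ Λ, glue Δ (swapSpins h q).1 ω i = glue Δ q.1 ω i := fun i hi => by
    rw [glue_swapSpins, glue_of_notMem hi]
  have hZ := (partitionZ_pos hp0 hp1 Δ hω).le
  unfold spinProb
  rw [hback, ← ENNReal.ofReal_mul (div_nonneg (niWeight_nonneg hp0 hp1 Δ _) hZ),
    ← ENNReal.ofReal_mul (div_nonneg (niWeight_nonneg hp0 hp1 Δ _) hZ), partitionZ_congr p hagree,
    ← glue_swapSpins h, div_mul_div_comm, div_mul_div_comm,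
    niWeight_mul_niWeight_comm p h hagree]

/-- The configuration drawn in `Δ` and the one obtained by resampling it in `Λ` are exchangeable, so
they have the same law. -/
theorem gibbsKernel_consistent {p : ℝ} (hp0 : 0 < p) (hp1 : p < 1) {Λ Δ : Finset ℤ} (h : Λ ⊆ Δ)
    {A : Set NonIsolated} (hA : MeasurableSet A) (ω : NonIsolated) :
    ∫⁻ η, gibbsKernel p Λ η A ∂(gibbsKernel p Δ ω) = gibbsKernel p Δ ω A := by
  have hmeas : Measurable fun η : NonIsolated => gibbsMeasure p Λ η A :=
    ((measurable_gibbsMeasure_apply p Λ hA).mono (spinSigma_le _) le_rfl).comp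
      measurable_subtype_coe
  simp only [gibbsKernel_apply]
  rw [lintegral_gibbsMeasure p Δ ω hmeas, gibbsMeasure_apply p Δ _ hA]
  have h1 : ∀ ξ : Δ → Bool, spinProb p Δ ξ ω * gibbsMeasure p Λ (thinMap (glue Δ ξ ω)) A =
      ∑ ζ : Λ → Bool, spinProb p Δ ξ ω * spinProb p Λ ζ (glue Δ ξ ω) *
        A.indicator 1 (thinMap (glue Λ ζ (glue Δ ξ ω))) := by
    intro ξ
    by_cases hξ : glue Δ ξ ω ∈ nonIsolated
    · have : ((thinMap (glue Δ ξ ω) : NonIsolated) : Config) = glue Δ ξ ω := thin_eq_self hξ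
      rw [this, gibbsMeasure_apply p Λ _ hA, Finset.mul_sum]
      exact Finset.sum_congr rfl fun ζ _ => (mul_assoc _ _ _).symm
    · simp [spinProb_eq_zero p Δ hξ]
  -- The factor `1 = ∑ ζ` of the `Λ`-probabilities is inserted so that both sides become sums over
  -- pairs, which the swap then matches.
  have h2 : ∀ ξ : Δ → Bool, spinProb p Δ ξ ω * A.indicator 1 (thinMap (glue Δ ξ ω)) =
      ∑ ζ : Λ → Bool, spinProb p Δ ξ ω * spinProb p Λ ζ (glue Δ ξ ω) *
        A.indicator 1 (thinMap (glue Δ ξ ω)) := by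
    intro ξ
    by_cases hξ : glue Δ ξ ω ∈ nonIsolated
    · rw [← Finset.sum_mul, ← Finset.mul_sum, sum_spinProb hp0 hp1 Λ hξ, mul_one]
    · simp [spinProb_eq_zero p Δ hξ]
  simp only [h1, h2]
  rw [← Fintype.sum_prod_type', ← Fintype.sum_prod_type',
    ← Equiv.sum_comp (swapSpins_involutive h).toPerm]
  refine Finset.sum_congr rfl fun q _ => ?_
  simp only [Function.Involutive.coe_toPerm]
  rw [spinProb_swapSpins hp0 hp1 h q ω ω.2]
  congr 3
  rw [← glue_swapSpins h, swapSpins_involutive h q]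

theorem isSpecification_gibbsKernel {p : ℝ} (hp0 : 0 < p) (hp1 : p < 1) :
    IsSpecification (gibbsKernel p) where
  isProbability Λ ω := isProbabilityMeasure_gibbsMeasure hp0 hp1 Λ ω.2
  proper Λ A hA ω := by
    have := isProbabilityMeasure_gibbsMeasure hp0 hp1 Λ ω.2
    rw [gibbsKernel_apply, ← Set.univ_inter A, gibbsMeasure_inter Λ ω MeasurableSet.univ hA]
    simp
  consistent Λ Δ h A hA ω := gibbsKernel_consistent hp0 hp1 h hA ω

theorem gibbsKernel_real_agree {p : ℝ} (hp0 : 0 < p) (hp1 : p < 1) (Λ : Finset ℤ)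
    (ω : NonIsolated) : (gibbsKernel p Λ ω).real {η | ∀ i ∈ Λ, η.1 i = ω.1 i} =
      (partitionZ p Λ ω)⁻¹ * weight p Λ ω := by
  have hA : MeasurableSet {η : NonIsolated | ∀ i ∈ Λ, η.1 i = ω.1 i} := by
    have : {η : NonIsolated | ∀ i ∈ Λ, η.1 i = ω.1 i} =
        Subtype.val ⁻¹' ⋂ i ∈ Λ, {η : Config | η i = ω.1 i} := by
      ext η
      simp
    rw [this]
    exact measurable_subtype_coe (Finset.measurableSet_biInter _ fun i _ => measurableSet_spin i _)
  rw [measureReal_def, gibbsKernel_apply, gibbsMeasure_apply p Λ _ hA,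
    Finset.sum_eq_single (fun i : Λ => ω.1 i)]
  · have hmem : thinMap (glue Λ (fun i => ω.1 i) ω) ∈
        {η : NonIsolated | ∀ i ∈ Λ, η.1 i = ω.1 i} := by
      rw [glue_self, thinMap_coe]
      exact fun _ _ => rfl
    rw [Set.indicator_of_mem hmem, spinProb, glue_self, niWeight_of_mem p Λ ω.2, Pi.one_apply,
      mul_one, ENNReal.toReal_ofReal (div_nonneg (weight_pos hp0 hp1 Λ ω).le
        (partitionZ_pos hp0 hp1 Λ ω.2).le), div_eq_inv_mul]
  · intro ζ _ hζ
    by_cases h : glue Λ ζ ω ∈ nonIsolated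
    · rw [Set.indicator_of_notMem, mul_zero]
      intro hmem
      refine hζ (funext fun i => ?_)
      have h' : thin (glue Λ ζ ω) i = ω.1 i := hmem i i.2
      rw [thin_eq_self h, glue_of_mem i.2] at h'
      exact h'
    · rw [spinProb_eq_zero p Λ h, zero_mul]
  · simp

/-! ### Independence under the Bernoulli field -/

instance (p : unitInterval) : IsProbabilityMeasure (bernoulliField p) := by
  unfold bernoulliField
  infer_instance

theorem spinSigma_mono {S T : Set ℤ} (h : S ⊆ T) : spinSigma S ≤ spinSigma T :=
  biSup_mono fun _ hi => h hi

theorem bernoulliField_real_inter (p : unitInterval) {S T : Set ℤ} (hST : Disjoint S T)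
    {A B : Set Config} (hA : MeasurableSet[spinSigma S] A) (hB : MeasurableSet[spinSigma T] B) :
    (bernoulliField p).real (A ∩ B) = (bernoulliField p).real A * (bernoulliField p).real B := by
  have h : iIndepFun (fun (i : ℤ) (ω : Config) => ω i) (bernoulliField p) :=
    iIndepFun_infinitePi (X := fun _ b => b) fun _ => measurable_id
  have h' := indep_iSup_of_disjoint (fun i => (measurable_pi_apply i).comap_le) h hST
  rw [measureReal_def, measureReal_def, measureReal_def, ← ENNReal.toReal_mul,
    (Indep_iff _ _ _).1 h' A B hA hB]

theorem bernoulliField_real_biInter (p : unitInterval) {ι : Type*} (F : Finset ι)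
    (S : ι → Set ℤ) (E : ι → Set Config) (hS : (F : Set ι).PairwiseDisjoint S)
    (hE : ∀ i ∈ F, MeasurableSet[spinSigma (S i)] (E i)) :
    (bernoulliField p).real (⋂ i ∈ F, E i) = ∏ i ∈ F, (bernoulliField p).real (E i) := by
  classical
  induction F using Finset.induction_on with
  | empty => simp
  | @insert a F ha ih =>
    have hrest : MeasurableSet[spinSigma (⋃ i ∈ F, S i)] (⋂ i ∈ F, E i) :=
      Finset.measurableSet_biInter _ fun i hi => spinSigma_mono
        (Set.subset_biUnion_of_mem (u := S) (show i ∈ (F : Set ι) from hi)) _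
        (hE i (Finset.mem_insert_of_mem hi))
    have hdisj : Disjoint (S a) (⋃ i ∈ F, S i) := by
      rw [Set.disjoint_iUnion₂_right]
      intro i hi
      exact hS (by simp) (by simp [hi]) fun h => ha (h ▸ hi)
    rw [Finset.set_biInter_insert, Finset.prod_insert ha,
      bernoulliField_real_inter p hdisj (hE a (by simp)) hrest,
      ih (hS.subset (by simp)) fun i hi => hE i (Finset.mem_insert_of_mem hi)]

theorem bernoulliField_real_spin (p : unitInterval) (i : ℤ) (b : Bool) :
    (bernoulliField p).real {ω | ω i = b} = if b then (p : ℝ) else 1 - p := by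
  have h := Measure.infinitePi_map_eval (μ := fun _ : ℤ => bernoulliMeasure true false p) i
  have h' : (bernoulliField p).real {ω | ω i = b} =
      (bernoulliMeasure true false p).real {b} := by
    rw [← h, map_measureReal_apply (measurable_pi_apply i) (measurableSet_singleton b)]
    rfl
  rw [h']
  cases b <;> simp

/-- No two adjacent sites of `U` are occupied. -/
def noAdjacent (U : Set ℤ) : Set Config :=
  {ω | ∀ i ∈ U, i + 1 ∈ U → ω i = false ∨ ω (i + 1) = false}

theorem measurableSet_noAdjacent (U : Set ℤ) : MeasurableSet[spinSigma U] (noAdjacent U) := by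
  have : noAdjacent U = ⋂ i ∈ {i | i ∈ U ∧ i + 1 ∈ U},
      {ω : Config | ω i = false} ∪ {ω : Config | ω (i + 1) = false} := by
    ext ω
    simp only [noAdjacent, Set.mem_iInter, Set.mem_ofPred_eq, Set.mem_union, and_imp]
  rw [this]
  exact MeasurableSet.biInter (Set.to_countable _) fun i hi =>
    (measurableSet_spinSigma hi.1 false).union (measurableSet_spinSigma hi.2 false)

/-- Both sides satisfy the same recursion with coefficients `1 - p` and `p(1 - p)`: the last site is
empty, or it is occupied and its left neighbour empty. Both equal `1` for `n = 0, 1`. -/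
theorem bernoulliField_real_noAdjacent (p : unitInterval) (hp1 : (p : ℝ) < 1) (a : ℤ) (n : ℕ) :
    (bernoulliField p).real (noAdjacent (Set.Ico a (a + n))) =
      (1 - (p : ℝ))⁻¹ * (transferMatrix p ^ (n + 1)) 0 0 := by
  have hq : 1 - (p : ℝ) ≠ 0 := by linarith
  induction n using Nat.strong_induction_on with
  | _ n ih =>
    match n with
    | 0 =>
      have : noAdjacent (Set.Ico a (a + (0 : ℕ))) = Set.univ := by
        ext ω
        simp [noAdjacent]
      rw [this]
      simp [transferMatrix, hq]
    | 1 =>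
      have : noAdjacent (Set.Ico a (a + (1 : ℕ))) = Set.univ := by
        refine Set.eq_univ_of_forall fun ω i hi hi' => ?_
        simp only [Set.mem_Ico, Nat.cast_one] at hi hi'
        omega
      rw [this, transferMatrix_pow_add_two p.2.1 p.2.2]
      simp [transferMatrix]
      field_simp
      ring
    | n + 2 =>
      have hA : noAdjacent (Set.Ico a (a + (n + 2 : ℕ))) =
          noAdjacent (Set.Ico a (a + (n + 1 : ℕ))) ∩ {ω | ω (a + n + 1) = false} ∪
          noAdjacent (Set.Ico a (a + n)) ∩
            ({ω | ω (a + n) = false} ∩ {ω | ω (a + n + 1) = true}) := by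
        ext ω
        simp only [noAdjacent, Set.mem_union, Set.mem_inter_iff, Set.mem_ofPred_eq, Set.mem_Ico,
          Nat.cast_add, Nat.cast_ofNat, Nat.cast_one]
        constructor
        · intro h
          cases hl : ω (a + n + 1)
          · exact Or.inl ⟨fun i hi hi' => h i (by omega) (by omega), rfl⟩
          · refine Or.inr ⟨fun i hi hi' => h i (by omega) (by omega), ?_, rfl⟩
            have := h (a + n) (by omega) (by omega)
            simpa [hl] using this
        · rintro (⟨h, hl⟩ | ⟨h, hl, hr⟩) i hi hi'
          · by_cases hin : i = a + n
            · subst hin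
              exact Or.inr hl
            · exact h i (by omega) (by omega)
          · by_cases hin : i = a + n
            · subst hin
              exact Or.inl hl
            · by_cases hin' : i + 1 = a + n
              · exact Or.inr (hin' ▸ hl)
              · exact h i (by omega) (by omega)
      have hm1 := measurableSet_spin (a + n + 1) true
      have hm2 := measurableSet_spin (a + n) false
      have hm3 := measurableSet_noAdjacent (Set.Ico a (a + n))
      have hr0 := measurableSet_spinSigma (Set.mem_singleton (a + n + 1 : ℤ)) false
      have hr1 := measurableSet_spinSigma (Set.mem_singleton (a + n + 1 : ℤ)) true
      have hl0 := measurableSet_spinSigma (Set.mem_singleton (a + n : ℤ)) false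
      have hpair := (measurableSet_spinSigma
        (Set.mem_insert (a + n : ℤ) {a + n + 1}) false).inter
          (measurableSet_spinSigma (Set.mem_insert_of_mem (a + n : ℤ)
            (Set.mem_singleton (a + n + 1 : ℤ))) true)
      rw [hA, measureReal_union ?_ ((spinSigma_le _ _ hm3).inter (hm2.inter hm1)),
        bernoulliField_real_inter p ?_ (measurableSet_noAdjacent _) hr0,
        bernoulliField_real_inter p ?_ hm3 hpair,
        bernoulliField_real_inter p ?_ hl0 hr1,
        ih (n + 1) (by omega), ih n (by omega), bernoulliField_real_spin,
        bernoulliField_real_spin, bernoulliField_real_spin,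
        transferMatrix_pow_add_two p.2.1 p.2.2 (n + 1)]
      · simp only [if_true, Bool.false_eq_true, if_false]
        ring
      · rw [Set.disjoint_singleton]
        omega
      · rw [Set.disjoint_left]
        rintro x hx (rfl | hx')
        · have := hx.2
          omega
        · have h1 : x = a + n + 1 := hx'
          have := hx.2
          omega
      · rw [Set.disjoint_singleton_right]
        intro hx
        have := hx.2
        push_cast at this
        omega
      · rw [Set.disjoint_left]
        rintro ω ⟨-, h0⟩ ⟨-, -, h1⟩
        have hoff : ω (a + n + 1) = false := h0
        have hocc : ω (a + n + 1) = true := h1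
        simp [hoff] at hocc

/-! ### The probability of a pattern -/

/-- The event that the configuration agrees with `η` on `[s, t]`. -/
def window (s t : ℤ) (η : Config) : Set NonIsolated := {ω | ∀ i ∈ Set.Icc s t, ω.1 i = η i}

theorem measurableSet_window (s t : ℤ) (η : Config) : MeasurableSet (window s t η) := by
  have : window s t η = Subtype.val ⁻¹' ⋂ i ∈ Set.Icc s t, {ω : Config | ω i = η i} := by
    ext ω
    simp [window]
  rw [this]
  exact measurable_subtype_coe
    (MeasurableSet.biInter (Set.to_countable _) fun i _ => measurableSet_spin i _)

/-- Two adjacent sites at each end of `[s, t]` are occupied. -/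
structure DoubleEnds (s t : ℤ) (η : Config) : Prop where
  left : η s = true
  left_succ : η (s + 1) = true
  right : η t = true
  right_pred : η (t - 1) = true

theorem graphClosure_Icc {s t : ℤ} (hst : s + 2 ≤ t) :
    graphClosure (Finset.Icc (s + 1) (t - 1) : Set ℤ) = Set.Icc s t := by
  ext x
  simp only [mem_graphClosure, Finset.coe_Icc, Set.mem_Icc, abs_le]
  constructor
  · rintro ⟨i, hi, hxi⟩
    omega
  · intro hx
    rcases lt_trichotomy x s with h | rfl | h
    · omega
    · exact ⟨x + 1, by omega, by omega⟩
    · rcases lt_trichotomy x t with h' | rfl | h'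
      · exact ⟨x, by omega, by omega⟩
      · exact ⟨x - 1, by omega, by omega⟩
      · omega

/-- A component of the unfixed area that comes close to a window between occupied sites lies
inside. -/
theorem subset_Ioo_of_mem_unfixed {s t : ℤ} {η : Config} (hs : η s = true) (ht : η t = true)
    {U : Set ℤ} (hU : U ∈ unfixed η) {y : ℤ} (hy : y ∈ U) (hsy : s - 1 ≤ y) (hyt : y ≤ t + 1) :
    U ⊆ Set.Ioo s t := by
  obtain ⟨-, hord, hsub, -⟩ := mem_components_iff.1 hU
  have hfix : ∀ x z, η x = true → |z - x| ≤ 1 → z ∉ U := fun x z hx hz hzU =>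
    hsub hzU (mem_graphClosure.2 ⟨x, hx, hz⟩)
  have hys : s < y := by
    by_contra h
    exact hfix s y hs (by rw [abs_le]; omega) hy
  have hyt : y < t := by
    by_contra h
    exact hfix t y ht (by rw [abs_le]; omega) hy
  intro z hz
  constructor
  · by_contra h
    exact hfix s s hs (by simp) (hord.out hz hy ⟨by omega, hys.le⟩)
  · by_contra h
    exact hfix t t ht (by simp) (hord.out hy hz ⟨hyt.le, by omega⟩)

theorem exists_eq_Ico {U : Set ℤ} (hne : U.Nonempty) (hord : U.OrdConnected) (hfin : U.Finite) :
    ∃ (a : ℤ) (n : ℕ), U = Set.Ico a (a + n) := by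
  have h1 := hne.csInf_mem hfin
  have h2 := hne.csSup_mem hfin
  have h3 := csInf_le hfin.bddBelow h2
  refine ⟨sInf U, (sSup U + 1 - sInf U).toNat, Set.Subset.antisymm (fun x hx => ?_) fun x hx => ?_⟩
  · have h4 := csInf_le hfin.bddBelow hx
    have h5 := le_csSup hfin.bddAbove hx
    exact ⟨h4, by omega⟩
  · exact hord.out h1 h2 ⟨hx.1, by have := hx.2; omega⟩

/-- Occupied sites of `η` must have been occupied already, a boundary site could not have been
removed as isolated, and an unfixed component must lose all its particles. The end pairs make this a
statement about the window alone. -/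
theorem mem_thinMap_preimage_window_iff {s t : ℤ} (hst : s + 2 ≤ t) {η : Config}
    (hη : η ∈ nonIsolated) (hd : DoubleEnds s t η) (ω : Config) :
    thinMap ω ∈ window s t η ↔
      (∀ x ∈ occupied η ∩ Set.Icc s t, ω x = true) ∧
      (∀ x ∈ outerBoundary (occupied η) ∩ Set.Icc s t, ω x = false) ∧
      ∀ U ∈ unfixedNear (Finset.Icc (s + 1) (t - 1)) η, ω ∈ noAdjacent U := by
  have hnear : ∀ U ∈ unfixedNear (Finset.Icc (s + 1) (t - 1)) η, U ⊆ Set.Ioo s t := by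
    rintro U ⟨hU, x, hx, y, hy, hxy⟩
    rw [graphClosure_Icc hst] at hx
    obtain ⟨hx1, hx2⟩ := hx
    rw [abs_le] at hxy
    exact subset_Ioo_of_mem_unfixed hd.left hd.right hU hy (by omega) (by omega)
  have hmem : thinMap ω ∈ window s t η ↔ ∀ i ∈ Set.Icc s t, thin ω i = η i := Iff.rfl
  rw [hmem]
  constructor
  · intro h
    refine ⟨?_, ?_, ?_⟩
    · rintro x ⟨hx, hxI⟩
      have hx' : η x = true := hx
      have h1 := h x hxI
      rw [hx', thin_eq_true_iff] at h1
      exact h1.1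
    · rintro x ⟨hx, hxI⟩
      obtain ⟨hx0, hxf⟩ := mem_outerBoundary_occupied.1 hx
      -- A boundary site is not an end of the window, so its occupied neighbour in `η` still lies
      -- inside.
      have hxs : x ≠ s := by
        rintro rfl
        simp [hd.left] at hx0
      have hxt : x ≠ t := by
        rintro rfl
        simp [hd.right] at hx0
      obtain ⟨hx1, hx2⟩ := hxI
      by_contra hω
      rw [Bool.not_eq_false] at hω
      have h1 := h x ⟨hx1, hx2⟩
      rw [hx0, ← Bool.not_eq_true, thin_eq_true_iff] at h1
      have hnb : ∀ i ∈ Set.Icc s t, η i = true → ω i = true := fun i hi hηi => by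
        have h2 := h i hi
        rw [hηi, thin_eq_true_iff] at h2
        exact h2.1
      rcases mem_fixedArea.1 hxf with h2 | h2 | h2
      · exact h1 ⟨hω, Or.inl (hnb _ ⟨by omega, by omega⟩ h2)⟩
      · simp [hx0] at h2
      · exact h1 ⟨hω, Or.inr (hnb _ ⟨by omega, by omega⟩ h2)⟩
    · intro U hU i hi hi'
      have hiI := hnear U hU hi
      have hη : η i ≠ true := fun hηi =>
        (mem_components_iff.1 hU.1).2.2.1 hi (mem_fixedArea.2 (Or.inr (Or.inl hηi)))
      rw [← h i ⟨hiI.1.le, hiI.2.le⟩, Ne, thin_eq_true_iff] at hη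
      cases h1 : ω i
      · exact Or.inl rfl
      · cases h2 : ω (i + 1)
        · exact Or.inr rfl
        · exact (hη ⟨h1, Or.inr h2⟩).elim
  · rintro ⟨hΘ, hB, hU⟩ i hi
    have hΘ' : ∀ x, s ≤ x → x ≤ t → η x = true → ω x = true := fun x h1 h2 h3 =>
      hΘ x ⟨h3, h1, h2⟩
    obtain ⟨his, hit⟩ := hi
    cases hηi : η i
    · rw [← Bool.not_eq_true, thin_eq_true_iff]
      rintro ⟨hωi, hnb⟩
      by_cases hfix : i ∈ fixedArea η
      · have := hB i ⟨mem_outerBoundary_occupied.2 ⟨hηi, hfix⟩, his, hit⟩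
        simp [hωi] at this
      have hnear' : Set.ordConnectedComponent (fixedArea η)ᶜ i ∈
          unfixedNear (Finset.Icc (s + 1) (t - 1)) η :=
        ⟨ordConnectedComponent_mem_components hfix, i, by
          rw [graphClosure_Icc hst]; exact ⟨his, hit⟩, i, by simpa using hfix, by simp⟩
      set U := Set.ordConnectedComponent (fixedArea η)ᶜ i with hUdef
      have hiU : i ∈ U := by simpa [hUdef] using hfix
      have hmax := (mem_components_iff.1 hnear'.1).2.2.2 i hiU
      have hIoo := hnear U hnear' hiU
      have hη' : ∀ y, |i - y| ≤ 1 → η y = false := fun y hy => by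
        rw [← Bool.not_eq_true]
        exact fun hηy => hfix (mem_graphClosure.2 ⟨y, hηy, hy⟩)
      -- A neighbour of `i` outside `U` is fixed by maximality and empty because `i` is unfixed.
      -- Hence it lies in `∂₊Θ`, where `ω` vanishes.
      have key : ∀ y, |i - y| ≤ 1 → y ∉ U → ω y = false := fun y hy hyU => by
        have hyf : y ∈ fixedArea η := by
          by_contra hyf
          exact hyU (hmax y hyf hy)
        rw [abs_le] at hy
        exact hB y ⟨mem_outerBoundary_occupied.2 ⟨hη' y (abs_le.2 hy), hyf⟩,
          by have := hIoo.1; omega, by have := hIoo.2; omega⟩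
      rcases hnb with hnb | hnb
      · by_cases hy : i - 1 ∈ U
        · have := hU U hnear' (i - 1) hy (by simpa using hiU)
          simp [hωi, hnb] at this
        · simp [key (i - 1) (by simp) hy] at hnb
      · by_cases hy : i + 1 ∈ U
        · have := hU U hnear' i hiU hy
          simp [hωi, hnb] at this
        · simp [key (i + 1) (by simp) hy] at hnb
    · rw [thin_eq_true_iff]
      refine ⟨hΘ' i his hit hηi, ?_⟩
      -- At the ends nothing is known about the neighbour outside the window, so survival relies on
      -- the second site of the pair.
      by_cases h1 : i = s
      · subst h1
        exact Or.inr (hΘ' _ (by omega) (by omega) hd.left_succ)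
      by_cases h2 : i = t
      · subst h2
        exact Or.inl (hΘ' _ (by omega) (by omega) hd.right_pred)
      rcases mem_nonIsolated_iff.1 hη i hηi with h | h
      · exact Or.inl (hΘ' _ (by omega) (by omega) h)
      · exact Or.inr (hΘ' _ (by omega) (by omega) h)

theorem bernoulliField_real_biInter_spin (p : unitInterval) {S : Set ℤ} (hS : S.Finite)
    (b : Bool) : (bernoulliField p).real (⋂ x ∈ hS.toFinset, {ω : Config | ω x = b}) =
      (if b then (p : ℝ) else 1 - p) ^ S.ncard := by
  rw [bernoulliField_real_biInter p _ (fun x => {x})]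
  · simp only [bernoulliField_real_spin, Finset.prod_const]
    rw [Set.ncard_eq_toFinset_card S hS]
  · intro x _ y _ hxy
    simpa [Function.onFun] using hxy
  · intro x _
    exact measurableSet_spinSigma (Set.mem_singleton x) b

/-- The three conditions on the preimage involve the disjoint sets `Θ`, `∂₊Θ` and the unfixed area,
and distinct components are disjoint, so the probability factorizes into the weight. All components
involved are finite here. -/
theorem thinnedField_real_window (p : unitInterval) (hp1 : (p : ℝ) < 1) {s t : ℤ}
    (hst : s + 2 ≤ t) {η : Config} (hη : η ∈ nonIsolated) (hd : DoubleEnds s t η) :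
    (thinnedField p).real (window s t η) = weight p (Finset.Icc (s + 1) (t - 1)) η := by
  set Λ := Finset.Icc (s + 1) (t - 1) with hΛ
  have hf1 : (occupied η ∩ Set.Icc s t).Finite := (Set.finite_Icc s t).inter_of_right _
  have hf2 : (outerBoundary (occupied η) ∩ Set.Icc s t).Finite :=
    (Set.finite_Icc s t).inter_of_right _
  have hpre : thinMap ⁻¹' window s t η = (⋂ x ∈ hf1.toFinset, {ω : Config | ω x = true}) ∩
      ((⋂ x ∈ hf2.toFinset, {ω : Config | ω x = false}) ∩
        ⋂ U ∈ (unfixedNear_finite Λ η).toFinset, noAdjacent U) := by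
    ext ω
    rw [Set.mem_preimage, mem_thinMap_preimage_window_iff hst hη hd]
    simp only [Set.mem_inter_iff, Set.mem_iInter, Set.Finite.mem_toFinset, Set.mem_ofPred_eq, hΛ]
  have hm1 : MeasurableSet[spinSigma (occupied η)]
      (⋂ x ∈ hf1.toFinset, {ω : Config | ω x = true}) :=
    Finset.measurableSet_biInter _ fun x hx =>
      measurableSet_spinSigma ((Set.Finite.mem_toFinset _).1 hx).1 true
  have hm2 : MeasurableSet[spinSigma (outerBoundary (occupied η))]
      (⋂ x ∈ hf2.toFinset, {ω : Config | ω x = false}) :=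
    Finset.measurableSet_biInter _ fun x hx =>
      measurableSet_spinSigma ((Set.Finite.mem_toFinset _).1 hx).1 false
  have hm3 : MeasurableSet[spinSigma (fixedArea η)ᶜ]
      (⋂ U ∈ (unfixedNear_finite Λ η).toFinset, noAdjacent U) :=
    Finset.measurableSet_biInter _ fun U hU =>
      spinSigma_mono (mem_components_iff.1 ((Set.Finite.mem_toFinset _).1 hU).1).2.2.1 _
        (measurableSet_noAdjacent U)
  have hd23 : Disjoint (outerBoundary (occupied η)) (fixedArea η)ᶜ :=
    Set.disjoint_left.2 fun x hx hx' => hx' (Or.inr hx)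
  have hd1 : Disjoint (occupied η) (outerBoundary (occupied η) ∪ (fixedArea η)ᶜ) :=
    Set.disjoint_left.2 fun x hx hx' => hx'.elim (fun h => h.1 hx) fun h => h (Or.inl hx)
  rw [thinnedField, map_measureReal_apply measurable_thinMap (measurableSet_window s t η), hpre,
    bernoulliField_real_inter p hd1 hm1 ((spinSigma_mono Set.subset_union_left _ hm2).inter
      (spinSigma_mono Set.subset_union_right _ hm3)),
    bernoulliField_real_inter p hd23 hm2 hm3, bernoulliField_real_biInter_spin,
    bernoulliField_real_biInter_spin, bernoulliField_real_biInter p _ id]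
  · simp only [weight, hΛ, graphClosure_Icc hst, if_true, Bool.false_eq_true, if_false, ← mul_assoc]
    congr 1
    refine Finset.prod_congr rfl fun U hU => ?_
    obtain ⟨hUc, x, hx, y, hy, hxy⟩ := (Set.Finite.mem_toFinset _).1 hU
    rw [graphClosure_Icc hst] at hx
    obtain ⟨hx1, hx2⟩ := hx
    rw [abs_le] at hxy
    have hfin : U.Finite := (Set.finite_Ioo s t).subset
      (subset_Ioo_of_mem_unfixed hd.left hd.right hUc hy (by omega) (by omega))
    obtain ⟨a, n, rfl⟩ := exists_eq_Ico ⟨y, hy⟩ (mem_components_iff.1 hUc).2.1 hfin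
    have hcard : (Set.Ico a (a + n)).ncard = n := by
      rw [← Finset.coe_Ico, Set.ncard_coe_finset, Int.card_Ico]
      omega
    rw [bernoulliField_real_noAdjacent p hp1, componentZ, if_pos hfin, hcard]
  · intro U hU V hV hUV
    refine Set.disjoint_left.2 fun x hxU hxV => hUV ?_
    exact components_eq_of_mem ((Set.Finite.mem_toFinset _).1 hU).1
      ((Set.Finite.mem_toFinset _).1 hV).1 hxU hxV
  · intro U _
    exact measurableSet_noAdjacent U

/-! ### Invariance of the thinned field under the Gibbs kernels -/

/-- `[s, t]` surrounds `Λ` and the origin, and `η` has occupied pairs at its ends. -/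
structure SurroundingWindow (Λ : Finset ℤ) (s t : ℤ) (η : Config) : Prop where
  -- Containing `[-1, 1]` makes any two windows overlap, so that their union is an interval, and
  -- gives `s + 2 ≤ t` even for empty `Λ`.
  left_neg : s ≤ -1
  right_pos : 1 ≤ t
  -- The margin of two keeps both sites of each end pair off `Λ`, so resampling in `Λ` preserves
  -- them.
  left_le : ∀ i ∈ Λ, s + 2 ≤ i
  le_right : ∀ i ∈ Λ, i ≤ t - 2
  ends : DoubleEnds s t η

theorem SurroundingWindow.congr {Λ : Finset ℤ} {s t : ℤ} {η ω : Config}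
    (h : SurroundingWindow Λ s t η)
    (hω : ∀ i ∈ Set.Icc s t, i ∉ Λ → ω i = η i) : SurroundingWindow Λ s t ω where
  left_neg := h.left_neg
  right_pos := h.right_pos
  left_le := h.left_le
  le_right := h.le_right
  ends := by
    have h1 := h.left_neg
    have h2 := h.right_pos
    have hoff : ∀ i, i < s + 2 ∨ t - 2 < i → i ∉ Λ := by
      intro i hi hiΛ
      have h3 := h.left_le i hiΛ
      have h4 := h.le_right i hiΛ
      omega
    constructor
    · rw [hω s ⟨by omega, by omega⟩ (hoff _ (by omega)), h.ends.left]
    · rw [hω _ ⟨by omega, by omega⟩ (hoff _ (by omega)), h.ends.left_succ]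
    · rw [hω t ⟨by omega, by omega⟩ (hoff _ (by omega)), h.ends.right]
    · rw [hω _ ⟨by omega, by omega⟩ (hoff _ (by omega)), h.ends.right_pred]

/-- The weight is a function of the spins in a surrounding window. -/
theorem weight_congr_of_window (p : ℝ) {Λ : Finset ℤ} {s t : ℤ} {ω η : Config}
    (hw : SurroundingWindow Λ s t η) (h : ∀ i ∈ Set.Icc s t, ω i = η i) :
    weight p Λ ω = weight p Λ η := by
  have hw' : SurroundingWindow Λ s t ω := hw.congr fun i hi _ => h i hi
  have hcl : ∀ x ∈ graphClosure (Λ : Set ℤ), s + 1 ≤ x ∧ x ≤ t - 1 := by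
    intro x hx
    obtain ⟨i, hi, hxi⟩ := mem_graphClosure.1 hx
    have h1 := hw.left_le i hi
    have h2 := hw.le_right i hi
    rw [abs_le] at hxi
    omega
  have hfix : ∀ x, s ≤ x → x ≤ t → (x ∈ fixedArea ω ↔ x ∈ fixedArea η) := by
    intro x hx1 hx2
    -- The end sites are occupied, hence fixed whatever happens outside the window.
    rcases hx1.eq_or_lt with rfl | hx1
    · simp [mem_fixedArea, hw.ends.left, hw'.ends.left]
    rcases hx2.eq_or_lt with rfl | hx2
    · simp [mem_fixedArea, hw.ends.right, hw'.ends.right]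
    · rw [mem_fixedArea, mem_fixedArea, h (x - 1) ⟨by omega, by omega⟩,
        h x ⟨by omega, by omega⟩, h (x + 1) ⟨by omega, by omega⟩]
  have hspin : ∀ x ∈ graphClosure (Λ : Set ℤ), ω x = η x := fun x hx => by
    have := hcl x hx
    exact h x ⟨by omega, by omega⟩
  have e1 : occupied ω ∩ graphClosure (Λ : Set ℤ) = occupied η ∩ graphClosure (Λ : Set ℤ) := by
    ext x
    refine and_congr_left fun hx => ?_
    change ω x = true ↔ η x = true
    rw [hspin x hx]
  have e2 : outerBoundary (occupied ω) ∩ graphClosure (Λ : Set ℤ) =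
      outerBoundary (occupied η) ∩ graphClosure (Λ : Set ℤ) := by
    ext x
    refine and_congr_left fun hx => ?_
    have := hcl x hx
    rw [mem_outerBoundary_occupied, mem_outerBoundary_occupied, hspin x hx,
      hfix x (by omega) (by omega)]
  have key : ∀ {ω η : Config}, SurroundingWindow Λ s t ω →
      (∀ x, s ≤ x → x ≤ t → (x ∈ fixedArea ω ↔ x ∈ fixedArea η)) →
      unfixedNear Λ ω ⊆ unfixedNear Λ η := by
    rintro ω η hω hfix U ⟨hU, x, hx, y, hy, hxy⟩
    have hx' := hcl x hx
    have hxy' := abs_le.1 hxy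
    have hIoo := subset_Ioo_of_mem_unfixed hω.ends.left hω.ends.right hU hy (by omega) (by omega)
    refine ⟨mem_components_congr (fun z hz w hzw => not_congr ?_) hU, x, hx, y, hy, hxy⟩
    have hz' := hIoo hz
    rw [abs_le] at hzw
    exact hfix w (by have := hz'.1; omega) (by have := hz'.2; omega)
  have e3 : unfixedNear Λ ω = unfixedNear Λ η :=
    (key hw' hfix).antisymm (key hw fun x h1 h2 => (hfix x h1 h2).symm)
  unfold weight
  rw [e1, e2]
  congr 1
  refine Finset.prod_congr ?_ fun _ _ => rfl
  rw [Set.Finite.toFinset_inj, e3]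

/-- Patching a non-isolated configuration inside a surrounding window. -/
theorem mem_nonIsolated_of_window {Λ : Finset ℤ} {s t : ℤ} {ω η ξ : Config}
    (hw : SurroundingWindow Λ s t η) (hω : ω ∈ nonIsolated) (hη : η ∈ nonIsolated)
    (hξω : ∀ i ∉ Λ, ξ i = ω i) (hξη : ∀ i ∈ Set.Icc s t, ξ i = η i) : ξ ∈ nonIsolated := by
  rw [mem_nonIsolated_iff] at *
  have hoff : ∀ i, i < s + 2 ∨ t - 2 < i → ξ i = ω i := by
    intro i hi
    refine hξω i fun hiΛ => ?_
    have h3 := hw.left_le i hiΛ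
    have h4 := hw.le_right i hiΛ
    omega
  intro i hi
  by_cases hin : s < i ∧ i < t
  · rw [hξη _ ⟨by omega, by omega⟩] at hi
    rw [hξη _ ⟨by omega, by omega⟩, hξη _ ⟨by omega, by omega⟩]
    exact hη i hi
  · rw [hoff _ (by omega)] at hi
    rw [hoff _ (by omega), hoff _ (by omega)]
    exact hω i hi

theorem niWeight_glue_congr_of_window (p : ℝ) {Λ : Finset ℤ} {s t : ℤ} {ω η : Config}
    (hw : SurroundingWindow Λ s t η) (hω : ω ∈ nonIsolated) (hη : η ∈ nonIsolated)
    (h : ∀ i ∈ Set.Icc s t, i ∉ Λ → ω i = η i) (ζ : Λ → Bool) :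
    niWeight p Λ (glue Λ ζ ω) = niWeight p Λ (glue Λ ζ η) := by
  have hw' := hw.congr h
  have hag : ∀ i ∈ Set.Icc s t, glue Λ ζ ω i = glue Λ ζ η i := by
    intro i hi
    by_cases hiΛ : i ∈ Λ
    · rw [glue_of_mem hiΛ, glue_of_mem hiΛ]
    · rw [glue_of_notMem hiΛ, glue_of_notMem hiΛ, h i hi hiΛ]
  have hg : ∀ {ω : Config}, SurroundingWindow Λ s t ω →
      SurroundingWindow Λ s t (glue Λ ζ ω) := fun hw =>
    hw.congr fun i _ hi => glue_of_notMem hi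
  by_cases hn : glue Λ ζ η ∈ nonIsolated
  · have hn' : glue Λ ζ ω ∈ nonIsolated :=
      mem_nonIsolated_of_window (hg hw) hω hn (fun i hi => glue_of_notMem hi) hag
    rw [niWeight_of_mem p Λ hn, niWeight_of_mem p Λ hn', weight_congr_of_window p (hg hw) hag]
  · have hn' : glue Λ ζ ω ∉ nonIsolated := fun hn' =>
      hn (mem_nonIsolated_of_window (hg hw') hη hn' (fun i hi => glue_of_notMem hi)
        fun i hi => (hag i hi).symm)
    rw [niWeight_of_notMem p Λ hn, niWeight_of_notMem p Λ hn']

/-- As a function of `ω` the kernel probability is a constant times the indicator of agreement with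
`η` in the window off `Λ`. Splitting that indicator by the spins in `Λ` expresses it through full
windows, whose probabilities are known. -/
theorem gibbsMeasure_window (p : ℝ) {Λ : Finset ℤ} {s t : ℤ} {η : Config}
    (hw : SurroundingWindow Λ s t η) (hη : η ∈ nonIsolated) (ω : NonIsolated) :
    gibbsMeasure p Λ ω (window s t η) = ∑ ζ : Λ → Bool,
      (window s t (glue Λ ζ η)).indicator 1 ω * spinProb p Λ (fun i => η i) η := by
  have hΛI : ∀ i ∈ Λ, i ∈ Set.Icc s t := fun i hi =>
    ⟨by have := hw.left_le i hi; omega, by have := hw.le_right i hi; omega⟩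
  rw [gibbsMeasure_apply p Λ _ (measurableSet_window s t η)]
  have hL : ∀ ζ : Λ → Bool, glue Λ ζ ω ∈ nonIsolated → thinMap (glue Λ ζ ω) ∈ window s t η →
      ζ = (fun i : Λ => η i) ∧ ∀ i ∈ Set.Icc s t, i ∉ Λ → ω.1 i = η i := by
    intro ζ hζ hmem
    have hmem' : ∀ i ∈ Set.Icc s t, thin (glue Λ ζ ω) i = η i := hmem
    rw [thin_eq_self hζ] at hmem'
    refine ⟨funext fun i => ?_, fun i hi hiΛ => ?_⟩
    · rw [← hmem' i (hΛI i i.2), glue_of_mem i.2]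
    · rw [← hmem' i hi, glue_of_notMem hiΛ]
  have hR : ∀ ζ : Λ → Bool, ω ∈ window s t (glue Λ ζ η) →
      ζ = (fun i : Λ => ω.1 i) ∧ ∀ i ∈ Set.Icc s t, i ∉ Λ → ω.1 i = η i := by
    intro ζ hmem
    refine ⟨funext fun i => ?_, fun i hi hiΛ => ?_⟩
    · rw [hmem i (hΛI i i.2), glue_of_mem i.2]
    · rw [hmem i hi, glue_of_notMem hiΛ]
  by_cases hag : ∀ i ∈ Set.Icc s t, i ∉ Λ → ω.1 i = η i
  · rw [Finset.sum_eq_single (fun i : Λ => η i), Finset.sum_eq_single (fun i : Λ => ω.1 i)]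
    · have hgη : ∀ i ∈ Set.Icc s t, glue Λ (fun i : Λ => η i) ω i = η i := by
        intro i hi
        by_cases hiΛ : i ∈ Λ
        · rw [glue_of_mem hiΛ]
        · rw [glue_of_notMem hiΛ, hag i hi hiΛ]
      have hn : glue Λ (fun i : Λ => η i) ω ∈ nonIsolated :=
        mem_nonIsolated_of_window hw ω.2 hη (fun i hi => glue_of_notMem hi) hgη
      have hm1 : thinMap (glue Λ (fun i : Λ => η i) ω) ∈ window s t η := by
        intro i hi
        change thin _ i = _
        rw [thin_eq_self hn, hgη i hi]
      have hm2 : ω ∈ window s t (glue Λ (fun i : Λ => ω.1 i) η) := by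
        intro i hi
        by_cases hiΛ : i ∈ Λ
        · rw [glue_of_mem hiΛ]
        · rw [glue_of_notMem hiΛ, hag i hi hiΛ]
      rw [Set.indicator_of_mem hm1, Set.indicator_of_mem hm2, Pi.one_apply, Pi.one_apply, mul_one,
        one_mul, spinProb, spinProb, partitionZ_eq, partitionZ_eq]
      simp only [niWeight_glue_congr_of_window p hw ω.2 hη hag]
    · intro ζ _ hζ
      rw [Set.indicator_of_notMem (fun h => hζ (hR ζ h).1), zero_mul]
    · simp
    · intro ζ _ hζ
      by_cases hn : glue Λ ζ ω ∈ nonIsolated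
      · rw [Set.indicator_of_notMem (fun h => hζ (hL ζ hn h).1), mul_zero]
      · rw [spinProb_eq_zero p Λ hn, zero_mul]
    · simp
  · rw [Finset.sum_eq_zero, Finset.sum_eq_zero]
    · intro ζ _
      rw [Set.indicator_of_notMem (fun h => hag (hR ζ h).2), zero_mul]
    · intro ζ _
      by_cases hn : glue Λ ζ ω ∈ nonIsolated
      · rw [Set.indicator_of_notMem (fun h => hag (hL ζ hn h).2), mul_zero]
      · rw [spinProb_eq_zero p Λ hn, zero_mul]

theorem thinnedField_window_glue (p : unitInterval) (hp1 : (p : ℝ) < 1) {Λ : Finset ℤ} {s t : ℤ}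
    {η : Config} (hw : SurroundingWindow Λ s t η) (hη : η ∈ nonIsolated) (ζ : Λ → Bool) :
    thinnedField p (window s t (glue Λ ζ η)) =
      ENNReal.ofReal (niWeight p (Finset.Icc (s + 1) (t - 1)) (glue Λ ζ η)) := by
  have hw' : SurroundingWindow Λ s t (glue Λ ζ η) := hw.congr fun i _ hi => glue_of_notMem hi
  by_cases hn : glue Λ ζ η ∈ nonIsolated
  · have h1 := hw.left_neg
    have h2 := hw.right_pos
    rw [niWeight_of_mem _ _ hn, ← thinnedField_real_window p hp1 (by omega) hn hw'.ends,
      ofReal_measureReal]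
  -- A non-isolated `ω` in this window, inserted into `η`, would make the glued configuration
  -- non-isolated.
  · have : window s t (glue Λ ζ η) = ∅ := by
      refine Set.eq_empty_of_forall_notMem fun ω hω => hn ?_
      exact mem_nonIsolated_of_window (hw'.congr fun i hi _ => hω i hi) hη ω.2
        (fun i hi => glue_of_notMem hi) fun i hi => (hω i hi).symm
    rw [this, niWeight_of_notMem _ _ hn, measure_empty, ENNReal.ofReal_zero]

/-- With `Δ = [s+1, t-1]` the integral is `∑ ζ, w_Δ(ζη) w_Λ(η) / Z_Λ(η)`. Detailed balance turns
this into `w_Δ(η) ∑ ζ, w_Λ(ζη) / Z_Λ(η) = w_Δ(η)`. -/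
theorem lintegral_gibbsMeasure_window (p : unitInterval) (hp0 : (0 : ℝ) < p) (hp1 : (p : ℝ) < 1)
    {Λ : Finset ℤ} {s t : ℤ} {η : Config} (hw : SurroundingWindow Λ s t η)
    (hη : η ∈ nonIsolated) :
    ∫⁻ ω, gibbsMeasure p Λ ω (window s t η) ∂(thinnedField p) =
      thinnedField p (window s t η) := by
  set Δ := Finset.Icc (s + 1) (t - 1) with hΔ
  have hΛΔ : Λ ⊆ Δ := fun i hi => by
    have h1 := hw.left_le i hi
    have h2 := hw.le_right i hi
    rw [hΔ, Finset.mem_Icc]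
    omega
  have hZ := partitionZ_pos hp0 hp1 Λ hη
  have hself := thinnedField_window_glue p hp1 hw hη (fun i => η i)
  rw [glue_self, ← hΔ] at hself
  simp only [gibbsMeasure_window p hw hη]
  rw [lintegral_finsetSum]
  · simp only [lintegral_mul_const _ (measurable_one.indicator (measurableSet_window s t _)),
      lintegral_indicator_one (measurableSet_window s t _), thinnedField_window_glue p hp1 hw hη]
    rw [hself, spinProb, glue_self]
    simp only [← ENNReal.ofReal_mul (niWeight_nonneg hp0 hp1 _ _)]
    rw [← ENNReal.ofReal_sum_of_nonneg fun ζ _ => mul_nonneg (niWeight_nonneg hp0 hp1 _ _)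
      (div_nonneg (niWeight_nonneg hp0 hp1 _ _) hZ.le)]
    congr 1
    have : ∀ ζ : Λ → Bool, niWeight p Δ (glue Λ ζ η) * (niWeight p Λ η / partitionZ p Λ η) =
        niWeight p Λ (glue Λ ζ η) * (niWeight p Δ η / partitionZ p Λ η) := by
      intro ζ
      have := niWeight_mul_niWeight_comm p hΛΔ (ω := glue Λ ζ η) (η := η)
        fun i hi => glue_of_notMem hi
      rw [mul_div_assoc', this, mul_comm (niWeight p Δ η), mul_div_assoc]
    simp only [← hΔ, this]
    rw [← Finset.sum_mul, ← partitionZ_eq, mul_div_cancel₀ _ hZ.ne']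
  · intro ζ _
    exact (measurable_one.indicator (measurableSet_window s t _)).mul_const _

/-! ### Occupied pairs on both sides -/

/-- There are occupied pairs arbitrarily far to the left and to the right. -/
def pairsBothSides : Set NonIsolated :=
  {ω | ∀ n : ℤ, (∃ s ≤ n, ω.1 s = true ∧ ω.1 (s + 1) = true) ∧
    ∃ t ≥ n, ω.1 t = true ∧ ω.1 (t - 1) = true}

theorem measurableSet_pairsBothSides : MeasurableSet pairsBothSides := by
  have : pairsBothSides = Subtype.val ⁻¹' ⋂ n : ℤ,
      ((⋃ s ∈ Set.Iic n, {ω : Config | ω s = true} ∩ {ω : Config | ω (s + 1) = true}) ∩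
        ⋃ t ∈ Set.Ici n, {ω : Config | ω t = true} ∩ {ω : Config | ω (t - 1) = true}) := by
    ext ω
    simp only [pairsBothSides, Set.mem_ofPred_eq, Set.mem_preimage, Set.mem_iInter,
      Set.mem_inter_iff, Set.mem_iUnion, exists_prop, Set.mem_Iic, Set.mem_Ici, ge_iff_le]
  rw [this]
  refine measurable_subtype_coe (MeasurableSet.iInter fun n => MeasurableSet.inter ?_ ?_)
  · exact MeasurableSet.biUnion (Set.to_countable _) fun s _ =>
      (measurableSet_spin s true).inter (measurableSet_spin _ true)
  · exact MeasurableSet.biUnion (Set.to_countable _) fun s _ =>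
      (measurableSet_spin s true).inter (measurableSet_spin _ true)

theorem exists_bounds (Λ : Finset ℤ) : ∃ a b : ℤ, ∀ i ∈ Λ, a ≤ i ∧ i ≤ b := by
  obtain ⟨a, ha⟩ := Λ.bddBelow
  obtain ⟨b, hb⟩ := Λ.bddAbove
  exact ⟨a, b, fun i hi => ⟨ha hi, hb hi⟩⟩

theorem mem_pairsBothSides_congr {Λ : Finset ℤ} {ω η : NonIsolated}
    (h : ∀ i ∉ Λ, η.1 i = ω.1 i) (hω : ω ∈ pairsBothSides) : η ∈ pairsBothSides := by
  obtain ⟨a, b, hab⟩ := exists_bounds Λ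
  intro n
  obtain ⟨⟨s, hs, hs1, hs2⟩, -⟩ := hω (min n (a - 2))
  obtain ⟨-, t, ht, ht1, ht2⟩ := hω (max n (b + 2))
  have h1 : ∀ i < a, i ∉ Λ := fun i hi hiΛ => by
    have := (hab i hiΛ).1
    omega
  have h2 : ∀ i > b, i ∉ Λ := fun i hi hiΛ => by
    have := (hab i hiΛ).2
    omega
  refine ⟨⟨s, by omega, ?_, ?_⟩, t, by omega, ?_, ?_⟩
  · rw [h _ (h1 _ (by omega)), hs1]
  · rw [h _ (h1 _ (by omega)), hs2]
  · rw [h _ (h2 _ (by omega)), ht1]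
  · rw [h _ (h2 _ (by omega)), ht2]

/-- Disjoint pairs are independent, so the first `n` all fail with probability `(1 - p²)^n`, which
tends to zero. -/
theorem ae_exists_pair (p : unitInterval) (hp0 : (0 : ℝ) < p) (c : ℕ → ℤ)
    (hc : Pairwise fun k l => Disjoint ({c k, c k + 1} : Set ℤ) {c l, c l + 1}) :
    ∀ᵐ ω ∂(bernoulliField p), ∃ k, ω (c k) = true ∧ ω (c k + 1) = true := by
  let E : ℕ → Set Config := fun k => ({ω | ω (c k) = true} ∩ {ω | ω (c k + 1) = true})ᶜ
  have hm : ∀ k, MeasurableSet ({ω : Config | ω (c k) = true} ∩ {ω | ω (c k + 1) = true}) :=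
    fun k => (measurableSet_spin _ _).inter (measurableSet_spin _ _)
  have hE : ∀ k, MeasurableSet[spinSigma {c k, c k + 1}] (E k) := fun k =>
    ((measurableSet_spinSigma (Set.mem_insert (c k) {c k + 1}) true).inter
      (measurableSet_spinSigma (Set.mem_insert_of_mem (c k)
        (Set.mem_singleton (c k + 1))) true)).compl
  have hprob : ∀ k, (bernoulliField p).real (E k) = 1 - (p : ℝ) * p := by
    intro k
    rw [probReal_compl_eq_one_sub (hm k), bernoulliField_real_inter p (S := {c k})
      (T := {c k + 1}) ?_ (measurableSet_spinSigma (Set.mem_singleton (c k)) true)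
      (measurableSet_spinSigma (Set.mem_singleton (c k + 1)) true), bernoulliField_real_spin,
      bernoulliField_real_spin]
    · simp
    · simp
  have hle : ∀ n : ℕ, (bernoulliField p).real (⋂ k, E k) ≤ (1 - (p : ℝ) * p) ^ n := by
    intro n
    have : (bernoulliField p).real (⋂ k ∈ Finset.range n, E k) = (1 - (p : ℝ) * p) ^ n := by
      rw [bernoulliField_real_biInter p _ (fun k => {c k, c k + 1}) E
        (fun k _ l _ hkl => hc hkl) fun k _ => hE k]
      simp [hprob]
    rw [← this]
    exact measureReal_mono fun ω hω => Set.mem_iInter₂.2 fun k _ => Set.mem_iInter.1 hω k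
  have hzero : (bernoulliField p).real (⋂ k, E k) = 0 := by
    refine le_antisymm (ge_of_tendsto' (tendsto_pow_atTop_nhds_zero_of_lt_one ?_ ?_) hle)
      measureReal_nonneg
    · nlinarith [p.2.1, p.2.2]
    · nlinarith
  rw [ae_iff]
  rw [measureReal_eq_zero_iff] at hzero
  refine measure_mono_null (fun ω hω => Set.mem_iInter.2 fun k hk => hω ⟨k, hk⟩) hzero

/-- Occupied pairs survive the thinning, as each site shields the other. It suffices to find them in
the Bernoulli field. -/
theorem thinnedField_compl_pairsBothSides (p : unitInterval) (hp0 : (0 : ℝ) < p) :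
    thinnedField p pairsBothSidesᶜ = 0 := by
  rw [thinnedField, Measure.map_apply measurable_thinMap measurableSet_pairsBothSides.compl]
  have hl : ∀ᵐ ω ∂(bernoulliField p), ∀ n : ℤ, ∃ k : ℕ,
      ω (n - 2 * k) = true ∧ ω (n - 2 * k + 1) = true := by
    rw [ae_all_iff]
    intro n
    refine ae_exists_pair p hp0 (fun k => n - 2 * k) fun k l hkl => ?_
    simp only [Set.disjoint_left, Set.mem_insert_iff, Set.mem_singleton_iff]
    omega
  have hr : ∀ᵐ ω ∂(bernoulliField p), ∀ n : ℤ, ∃ k : ℕ,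
      ω (n + 2 * k) = true ∧ ω (n + 2 * k + 1) = true := by
    rw [ae_all_iff]
    intro n
    refine ae_exists_pair p hp0 (fun k => n + 2 * k) fun k l hkl => ?_
    simp only [Set.disjoint_left, Set.mem_insert_iff, Set.mem_singleton_iff]
    omega
  have hall : ∀ᵐ ω ∂(bernoulliField p), thinMap ω ∈ pairsBothSides := by
    filter_upwards [hl, hr] with ω hl hr n
    obtain ⟨k, hk1, hk2⟩ := hl n
    obtain ⟨l, hl1, hl2⟩ := hr n
    change (∃ s ≤ n, thin ω s = true ∧ thin ω (s + 1) = true) ∧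
      ∃ t ≥ n, thin ω t = true ∧ thin ω (t - 1) = true
    simp only [thin_eq_true_iff]
    refine ⟨⟨n - 2 * k, by omega, ⟨hk1, Or.inr hk2⟩, hk2, Or.inl (by simpa using hk1)⟩,
      n + 2 * l + 1, by omega, ⟨hl2, Or.inl (by simpa using hl1)⟩, by simpa using hl1,
      Or.inr (by simpa using hl2)⟩
  exact hall

/-! ### The DLR equations -/

/-- The events of agreeing with a non-isolated pattern on a surrounding window. -/
def windowEvents (Λ : Finset ℤ) : Set (Set NonIsolated) :=
  {C | ∃ s t : ℤ, ∃ η ∈ nonIsolated, SurroundingWindow Λ s t η ∧ C = window s t η}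

theorem countable_windowEvents (Λ : Finset ℤ) : (windowEvents Λ).Countable := by
  have h : windowEvents Λ ⊆ ⋃ q : ℤ × ℤ, Set.range (window q.1 q.2) := by
    rintro C ⟨s, t, η, -, -, rfl⟩
    exact Set.mem_iUnion.2 ⟨(s, t), η, rfl⟩
  refine (Set.countable_iUnion fun q => ?_).mono h
  have : Set.range (window q.1 q.2) ⊆ Set.range fun ζ : Set.Icc q.1 q.2 → Bool =>
      {ω : NonIsolated | ∀ i : Set.Icc q.1 q.2, ω.1 i = ζ i} := by
    rintro _ ⟨η, rfl⟩
    refine ⟨fun i => η i, ?_⟩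
    ext ω
    simp [window]
  exact (Set.countable_range _).mono this

/-- Any common point `ω` serves as pattern on the union of the two intervals, which is again an
interval because they overlap. The outermost end pairs bound it. -/
theorem window_inter_mem_windowEvents {Λ : Finset ℤ} {C D : Set NonIsolated}
    (hC : C ∈ windowEvents Λ) (hD : D ∈ windowEvents Λ) (hne : (C ∩ D).Nonempty) :
    C ∩ D ∈ windowEvents Λ := by
  obtain ⟨s, t, η, -, hw, rfl⟩ := hC
  obtain ⟨s', t', η', -, hw', rfl⟩ := hD
  obtain ⟨ω, hω, hω'⟩ := hne
  have h := hw.congr (ω := ω) fun i hi _ => hω i hi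
  have h' := hw'.congr (ω := ω) fun i hi _ => hω' i hi
  have a1 := h.left_neg
  have a2 := h.right_pos
  have a3 := h'.left_neg
  have a4 := h'.right_pos
  refine ⟨min s s', max t t', ω, ω.2, ?_, ?_⟩
  · constructor
    · omega
    · omega
    · intro i hi
      have := h.left_le i hi
      omega
    · intro i hi
      have := h.le_right i hi
      omega
    · rcases min_choice s s' with e | e <;> rcases max_choice t t' with e' | e' <;>
        rw [e, e']
      · exact h.ends
      · exact ⟨h.ends.left, h.ends.left_succ, h'.ends.right, h'.ends.right_pred⟩
      · exact ⟨h'.ends.left, h'.ends.left_succ, h.ends.right, h.ends.right_pred⟩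
      · exact h'.ends
  · ext ξ
    constructor
    · rintro ⟨hξ, hξ'⟩ i ⟨hi1, hi2⟩
      by_cases hi : s ≤ i ∧ i ≤ t
      · rw [hξ i hi, hω i hi]
      · by_cases hi' : s' ≤ i ∧ i ≤ t'
        · rw [hξ' i hi', hω' i hi']
        · omega
    · intro hξ
      constructor
      · rintro i ⟨hi1, hi2⟩
        rw [hξ i ⟨by omega, by omega⟩, hω i ⟨hi1, hi2⟩]
      · rintro i ⟨hi1, hi2⟩
        rw [hξ i ⟨by omega, by omega⟩, hω' i ⟨hi1, hi2⟩]

/-- The window events, together with the events on which occupied pairs are missing far out on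
some side. -/
def windowPiSystem (Λ : Finset ℤ) : Set (Set NonIsolated) :=
  -- Including all measurable subsets of the null set makes the system generate the σ-algebra
  -- exactly, not merely up to null sets.
  windowEvents Λ ∪ {B | MeasurableSet B ∧ B ⊆ pairsBothSidesᶜ}

theorem measurableSet_of_mem_windowPiSystem {Λ : Finset ℤ} {C : Set NonIsolated}
    (hC : C ∈ windowPiSystem Λ) : MeasurableSet C := by
  rcases hC with ⟨s, t, η, -, -, rfl⟩ | h
  · exact measurableSet_window s t η
  · exact h.1

theorem isPiSystem_windowPiSystem (Λ : Finset ℤ) : IsPiSystem (windowPiSystem Λ) := by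
  intro C hC D hD hne
  by_cases hCw : C ∈ windowEvents Λ
  · by_cases hDw : D ∈ windowEvents Λ
    · exact Or.inl (window_inter_mem_windowEvents hCw hDw hne)
    · exact Or.inr ⟨(measurableSet_of_mem_windowPiSystem hC).inter
        (measurableSet_of_mem_windowPiSystem hD),
        Set.inter_subset_right.trans (hD.resolve_left hDw).2⟩
  · exact Or.inr ⟨(measurableSet_of_mem_windowPiSystem hC).inter
      (measurableSet_of_mem_windowPiSystem hD),
      Set.inter_subset_left.trans (hC.resolve_left hCw).2⟩

theorem exists_window_subset (Λ : Finset ℤ) {ω : NonIsolated} (hω : ω ∈ pairsBothSides) (i : ℤ) :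
    ∃ C ∈ windowEvents Λ, ω ∈ C ∧ ∀ η ∈ C, η.1 i = ω.1 i := by
  obtain ⟨a, b, hab⟩ := exists_bounds Λ
  obtain ⟨⟨s, hs, hs1, hs2⟩, -⟩ := hω (min (min (-1) i) (a - 2))
  obtain ⟨-, t, ht, ht1, ht2⟩ := hω (max (max 1 i) (b + 2))
  refine ⟨window s t ω, ⟨s, t, ω, ω.2, ⟨by omega, by omega, fun j hj => ?_, fun j hj => ?_,
    ⟨hs1, hs2, ht1, ht2⟩⟩, rfl⟩, fun _ _ => rfl, fun η hη => hη i ⟨by omega, by omega⟩⟩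
  · have := (hab j hj).1
    omega
  · have := (hab j hj).2
    omega

/-- Where pairs occur far out on both sides, a spin event is the countable union of the windows
contained in it. The rest of it is one of the adjoined sets. -/
theorem generateFrom_windowPiSystem (Λ : Finset ℤ) :
    (inferInstance : MeasurableSpace NonIsolated) =
      MeasurableSpace.generateFrom (windowPiSystem Λ) := by
  refine le_antisymm ?_ (MeasurableSpace.generateFrom_le fun C hC =>
    measurableSet_of_mem_windowPiSystem hC)
  have hval : Measurable[MeasurableSpace.generateFrom (windowPiSystem Λ)]
      (Subtype.val : NonIsolated → Config) := by
    refine @measurable_pi_lambda _ _ _ (MeasurableSpace.generateFrom (windowPiSystem Λ)) _ _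
      fun i => ?_
    refine @measurable_to_bool _ (MeasurableSpace.generateFrom (windowPiSystem Λ)) _ ?_
    have hmeas : MeasurableSet {ω : NonIsolated | ω.1 i = true} :=
      measurable_subtype_coe (measurableSet_spin i true)
    have heq : (fun ω : NonIsolated => ω.1 i) ⁻¹' {true} =
        ({ω | ω.1 i = true} ∩ pairsBothSidesᶜ) ∪
          ⋃ C ∈ {C | C ∈ windowEvents Λ ∧ C ⊆ {ω | ω.1 i = true}}, C := by
      ext ω
      constructor
      · intro h
        have h' : ω.1 i = true := h
        by_cases hω : ω ∈ pairsBothSides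
        · obtain ⟨C, hC, hωC, hCi⟩ := exists_window_subset Λ hω i
          refine Or.inr (Set.mem_biUnion (show C ∈ {C | C ∈ windowEvents Λ ∧
            C ⊆ {ω | ω.1 i = true}} from ⟨hC, fun η hη => ?_⟩) hωC)
          exact (hCi η hη).trans h'
        · exact Or.inl ⟨h', hω⟩
      · rintro (h | h)
        · exact h.1
        · obtain ⟨C, hC, hωC⟩ := Set.mem_iUnion₂.1 h
          exact hC.2 hωC
    rw [heq]
    refine MeasurableSet.union (MeasurableSpace.measurableSet_generateFrom (Or.inr
      ⟨hmeas.inter measurableSet_pairsBothSides.compl, Set.inter_subset_right⟩)) ?_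
    exact MeasurableSet.biUnion ((countable_windowEvents Λ).mono fun C hC => hC.1) fun C hC =>
      MeasurableSpace.measurableSet_generateFrom (Or.inl hC.1)
  exact hval.comap_le

theorem measurable_gibbsMeasure (p : ℝ) (Λ : Finset ℤ) :
    Measurable fun ω : NonIsolated => gibbsMeasure p Λ ω :=
  Measure.measurable_of_measurable_coe _ fun _ hA =>
    ((measurable_gibbsMeasure_apply p Λ hA).mono (spinSigma_le _) le_rfl).comp
      measurable_subtype_coe

theorem gibbsMeasure_compl_pairsBothSides (p : ℝ) (Λ : Finset ℤ) {ω : NonIsolated}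
    (hω : ω ∈ pairsBothSides) : gibbsMeasure p Λ ω pairsBothSidesᶜ = 0 := by
  rw [gibbsMeasure_apply p Λ _ measurableSet_pairsBothSides.compl]
  refine Finset.sum_eq_zero fun ζ _ => ?_
  by_cases hn : glue Λ ζ ω ∈ nonIsolated
  · rw [Set.indicator_of_notMem, mul_zero]
    refine fun h => h (mem_pairsBothSides_congr (Λ := Λ) (fun i hi => ?_) hω)
    change thin (glue Λ ζ ω) i = ω.1 i
    rw [thin_eq_self hn, glue_of_notMem hi]
  · rw [spinProb_eq_zero p Λ hn, zero_mul]

/-- Both measures agree on windows by detailed balance. They vanish on the adjoined sets because a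
kernel cannot destroy the pairs far out. -/
theorem bind_gibbsMeasure (p : unitInterval) (hp0 : (0 : ℝ) < p) (hp1 : (p : ℝ) < 1)
    (Λ : Finset ℤ) :
    (thinnedField p).bind (fun ω : NonIsolated => gibbsMeasure p Λ ω) = thinnedField p := by
  have hbind : ∀ A : Set NonIsolated, MeasurableSet A →
      (thinnedField p).bind (fun ω : NonIsolated => gibbsMeasure p Λ ω) A =
        ∫⁻ ω, gibbsMeasure p Λ ω A ∂(thinnedField p) := fun A hA =>
    Measure.bind_apply hA (measurable_gibbsMeasure p Λ).aemeasurable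
  have huniv : thinnedField p Set.univ =
      (thinnedField p).bind (fun ω : NonIsolated => gibbsMeasure p Λ ω) Set.univ := by
    rw [hbind _ MeasurableSet.univ]
    have : ∀ ω : NonIsolated, gibbsMeasure p Λ ω Set.univ = 1 := fun ω =>
      (isProbabilityMeasure_gibbsMeasure hp0 hp1 Λ ω.2).measure_univ
    simp [this]
  refine (ext_of_generate_finite _ (generateFrom_windowPiSystem Λ)
    (isPiSystem_windowPiSystem Λ) ?_ huniv).symm
  intro C hC
  rw [hbind C (measurableSet_of_mem_windowPiSystem hC)]
  rcases hC with ⟨s, t, η, hη, hw, rfl⟩ | ⟨hC, hCsub⟩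
  · exact (lintegral_gibbsMeasure_window p hp0 hp1 hw hη).symm
  · have hnull := thinnedField_compl_pairsBothSides p hp0
    rw [measure_mono_null hCsub hnull, eq_comm]
    refine lintegral_eq_zero_of_ae_eq_zero ?_
    have hae : ∀ᵐ ω ∂(thinnedField p), ω ∈ pairsBothSides := hnull
    filter_upwards [hae] with ω hω
    exact measure_mono_null hCsub (gibbsMeasure_compl_pairsBothSides p Λ hω)

theorem isGibbs_gibbsKernel (p : unitInterval) (hp0 : (0 : ℝ) < p) (hp1 : (p : ℝ) < 1) :
    IsGibbs (thinnedField p) (gibbsKernel p) := by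
  intro Λ A hA
  have hm := spinSigma'_le (Λ : Set ℤ)ᶜ
  have hprob : ∀ ω : NonIsolated, IsProbabilityMeasure (gibbsMeasure p Λ ω) := fun ω =>
    isProbabilityMeasure_gibbsMeasure hp0 hp1 Λ ω.2
  have hmeas : Measurable[spinSigma' (Λ : Set ℤ)ᶜ]
      fun ω : NonIsolated => gibbsMeasure p Λ ω A :=
    (measurable_gibbsMeasure_apply p Λ hA).comp (comap_measurable _)
  have hmeas' : Measurable fun ω : NonIsolated => gibbsMeasure p Λ ω A := hmeas.mono hm le_rfl
  have hint : Integrable (fun ω : NonIsolated => (gibbsMeasure p Λ ω).real A)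
      (thinnedField p) := by
    refine Integrable.of_bound (C := 1) hmeas'.ennreal_toReal.aestronglyMeasurable
      (Filter.Eventually.of_forall fun ω => ?_)
    rw [Real.norm_of_nonneg measureReal_nonneg]
    exact measureReal_le_one
  refine (ae_eq_condExp_of_forall_setIntegral_eq hm ((integrable_const 1).indicator hA)
    (fun B _ _ => hint.integrableOn) (fun B hB _ => ?_)
    (Measurable.ennreal_toReal hmeas).stronglyMeasurable.aestronglyMeasurable).symm
  have hB' : MeasurableSet B := hm _ hB
  -- Invariance is applied to `A ∩ B`, and `B` leaves the kernel as an indicator since it is an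
  -- event off `Λ`.
  have h1 : ∫⁻ ω in B, gibbsMeasure p Λ ω A ∂(thinnedField p) = thinnedField p (A ∩ B) := by
    have h := bind_gibbsMeasure p hp0 hp1 Λ
    conv_rhs => rw [← h, Measure.bind_apply (hA.inter hB')
      (measurable_gibbsMeasure p Λ).aemeasurable]
    simp only [gibbsMeasure_inter Λ _ hA hB]
    rw [← lintegral_indicator hB']
    refine lintegral_congr fun ω => ?_
    by_cases hω : ω ∈ B <;> simp [hω]
  have h2 : ∫ ω : NonIsolated in B, (gibbsMeasure p Λ ω).real A ∂(thinnedField p) =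
      (∫⁻ ω in B, gibbsMeasure p Λ ω A ∂(thinnedField p)).toReal :=
    integral_toReal hmeas'.aemeasurable
      (Filter.Eventually.of_forall fun ω => measure_lt_top (gibbsMeasure p Λ ω) A)
  rw [h2, h1, setIntegral_indicator hA, setIntegral_const, smul_eq_mul, mul_one,
    Set.inter_comm, measureReal_def]

end TBF

end

theorem mainTheorem1 (p : unitInterval) (hp0 : 0 < p) (hp1 : p < 1) :
    ∃ γ : TBF.KernelFamily, TBF.IsSpecification γ ∧ TBF.IsGibbs (TBF.thinnedField p) γ ∧
      ∀ (Λ : Finset ℤ) (ω : TBF.NonIsolated),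
        0 < TBF.partitionZ p Λ ω ∧
        (γ Λ ω).real {η | ∀ i ∈ Λ, η.1 i = ω.1 i} =
          (TBF.partitionZ p Λ ω)⁻¹ * TBF.weight p Λ ω := by
  have h0 : (0 : ℝ) < p := hp0
  have h1 : (p : ℝ) < 1 := hp1
  exact ⟨TBF.gibbsKernel p, TBF.isSpecification_gibbsKernel h0 h1,
    TBF.isGibbs_gibbsKernel p h0 h1, fun Λ ω =>
      ⟨TBF.partitionZ_pos h0 h1 Λ ω.2, TBF.gibbsKernel_real_agree h0 h1 Λ ω⟩⟩
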